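/- Let $\mathbb K=\mathbb R$ or $\mathbb C$, let $H^1(\mathbb R^3)$ be the Sobolev space of $\mathbb K$-valued functions, and for $u\in H^1(\mathbb R^3)$ put $$D[u]:=\iint_{\mathbb R^3\times\mathbb R^3}\frac{|u(x)|^2\,|u(x')|^2}{|x-x'|}\,dx\,dx'.$$ For $\alpha=\tfrac12$ and $C>0$ consider the energy $$E[u]:=\frac12\int_{\mathbb R^3}|\nabla u|^2\,dx+\frac14\,D[u]-\frac{C}{2\alpha+2}\int_{\mathbb R^3}|u|^{2\alpha+2}\,dx=\frac12\int_{\mathbb R^3}|\nabla u|^2\,dx+\frac14\,D[u]-\frac C3\int_{\mathbb R^3}|u|^3\,dx$$ and, for $M>0$, the minimization problem $$I_M:=\inf\{E[u]:u\in\Sigma_M\},\qquad \Sigma_M:=\{u\in H^1(\mathbb R^3):\|u\|_{L^2(\mathbb R^3)}^2=M\}.$$ Let $C_{1/2}$ be the best constant in the inequality $$\|u\|_{L^3(\mathbb R^3)}^3\le C_{1/2}\,D[u]^{1/2}\,\|\nabla u\|_{L^2(\mathbb R^3)}\qquad\text{for all }u\in H^1(\mathbb R^3).$$ **Proposition.**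 Assume that $\alpha=\tfrac12$ and $C=\dfrac{3}{\sqrt2\,C_{1/2}}$. Let $(\phi_n)_n$ be a minimizing sequence for $I_1$, that is, $\phi_n\in\Sigma_1$ for every $n$ and $E[\phi_n]\to I_1$. Suppose that it does not vanish, in the sense that there exist $R_0>0$, $\varepsilon_0>0$ and a sequence $(y_n)_n$ in $\mathbb R^3$ such that $$\int_{B(y_n,R_0)}|\phi_n|^2\,dx\ge\varepsilon_0\qquad\text{for every }n.$$ Then there exists a minimizer for $I_1$, that is, some $\phi\in\Sigma_1$ with $E[\phi]=I_1$. -/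

import Mathlib

open MeasureTheory Filter Topology
open scoped ContDiff

noncomputable section

namespace XSP

/-- The space `ℝ³` with its Euclidean norm and Lebesgue measure. -/
abbrev R3 : Type := EuclideanSpace ℝ (Fin 3)

/-- `g` is the weak partial derivative `∂ᵢ u` (tested against smooth compactly supported
real functions). It is only used for `u`, `g` in `L²`, where all the integrals converge. -/
def HasWeakPartial {𝕜 : Type*} [RCLike 𝕜] (i : Fin 3) (u g : R3 → 𝕜) : Prop :=
  ∀ η : R3 → ℝ, ContDiff ℝ ∞ η → HasCompactSupport η →
    ∫ x, (fderiv ℝ η x (EuclideanSpace.single i 1)) • u x = - ∫ x, η x • g x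

/-- `u` has a weak partial derivative `∂ᵢ u` in `L²(ℝ³)`. -/
def HasL2Partial {𝕜 : Type*} [RCLike 𝕜] (i : Fin 3) (u : R3 → 𝕜) : Prop :=
  ∃ g : R3 → 𝕜, MemLp g 2 volume ∧ HasWeakPartial i u g

/-- The Sobolev space `H¹(ℝ³)` of `𝕜`-valued functions. -/
def H1 (𝕜 : Type*) [RCLike 𝕜] : Set (R3 → 𝕜) :=
  {u | MemLp u 2 volume ∧ ∀ i, HasL2Partial i u}

open Classical in
/-- The weak partial derivative `∂ᵢ u` in `L²` when it exists (it is then unique almost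
everywhere, see `weakPartial_ae_unique`), and `0` otherwise. -/
def weakPartial {𝕜 : Type*} [RCLike 𝕜] (i : Fin 3) (u : R3 → 𝕜) : R3 → 𝕜 :=
  if h : HasL2Partial i u then h.choose else 0

theorem weakPartial_spec {𝕜 : Type*} [RCLike 𝕜] {i : Fin 3} {u : R3 → 𝕜}
    (h : HasL2Partial i u) :
    MemLp (weakPartial i u) 2 volume ∧ HasWeakPartial i u (weakPartial i u) := by
  unfold weakPartial
  rw [dif_pos h]
  exact h.choose_spec

theorem weakPartial_ae_unique {𝕜 : Type*} [RCLike 𝕜] {i : Fin 3} {u g : R3 → 𝕜}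
    (hg : MemLp g 2 volume) (hug : HasWeakPartial i u g) :
    weakPartial i u =ᵐ[volume] g := by
  obtain ⟨hw, huw⟩ := weakPartial_spec (i := i) (u := u) ⟨g, hg, hug⟩
  have hwl := hw.locallyIntegrable (by norm_num)
  have hgl := hg.locallyIntegrable (by norm_num)
  refine ae_eq_of_integral_contDiff_smul_eq hwl hgl fun η hη hc => ?_
  have h := (huw η hη hc).symm.trans (hug η hη hc)
  exact neg_injective h

/-- The mass `∫ |u|² = ‖u‖₂²`. -/
def mass {𝕜 : Type*} [RCLike 𝕜] (u : R3 → 𝕜) : ℝ := ∫ x, ‖u x‖ ^ 2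

/-- The Dirichlet integral `∫ |∇u|² = ‖∇u‖₂²`. -/
def gradSq {𝕜 : Type*} [RCLike 𝕜] (u : R3 → 𝕜) : ℝ :=
  ∫ x, ∑ i : Fin 3, ‖weakPartial i u x‖ ^ 2

/-- The Coulomb energy `D[u] = ∬ |u(x)|² |u(x')|² / |x - x'| dx dx'`. -/
def coulomb {𝕜 : Type*} [RCLike 𝕜] (u : R3 → 𝕜) : ℝ :=
  ∫ p : R3 × R3, ‖u p.1‖ ^ 2 * ‖u p.2‖ ^ 2 / ‖p.1 - p.2‖

/-- The integral `∫ |u|^(2α+2) = ‖u‖_{2α+2}^{2α+2}`. -/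
def powerInt {𝕜 : Type*} [RCLike 𝕜] (α : ℝ) (u : R3 → 𝕜) : ℝ :=
  ∫ x, ‖u x‖ ^ (2 * α + 2)

/-- The energy
`E[u] = 1/2 ∫ |∇u|² + 1/4 D[u] - C/(2α+2) ∫ |u|^(2α+2)` (repulsive case). -/
def energy {𝕜 : Type*} [RCLike 𝕜] (α C : ℝ) (u : R3 → 𝕜) : ℝ :=
  1 / 2 * gradSq u + 1 / 4 * coulomb u - C / (2 * α + 2) * powerInt α u

/-- The constraint set `Σ_M` of `H¹` functions of mass `M`. -/
def massSet (𝕜 : Type*) [RCLike 𝕜] (M : ℝ) : Set (R3 → 𝕜) :=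
  {u | u ∈ H1 𝕜 ∧ mass u = M}

/-- The infimum `I_M` of the energy on `Σ_M`, in `[-∞, +∞]`. -/
def infEnergy (𝕜 : Type*) [RCLike 𝕜] (α C M : ℝ) : EReal :=
  ⨅ u ∈ massSet 𝕜 M, (energy α C u : EReal)

/-- `u` is a minimizer for `I_M`. -/
def IsMinimizer {𝕜 : Type*} [RCLike 𝕜] (α C M : ℝ) (u : R3 → 𝕜) : Prop :=
  u ∈ massSet 𝕜 M ∧ (energy α C u : EReal) = infEnergy 𝕜 α C M

/-- `(φ n)` is a minimizing sequence for `I_M`. -/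
def IsMinimizingSeq {𝕜 : Type*} [RCLike 𝕜] (α C M : ℝ) (φ : ℕ → R3 → 𝕜) : Prop :=
  (∀ n, φ n ∈ massSet 𝕜 M) ∧
    Tendsto (fun n => (energy α C (φ n) : EReal)) atTop (𝓝 (infEnergy 𝕜 α C M))

/-- Non-vanishing: a fixed amount of mass stays in balls of a fixed radius, up to
translations. -/
def Nonvanishing {𝕜 : Type*} [RCLike 𝕜] (φ : ℕ → R3 → 𝕜) : Prop :=
  ∃ R₀ : ℝ, 0 < R₀ ∧ ∃ ε₀ : ℝ, 0 < ε₀ ∧ ∃ y : ℕ → R3,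
    ∀ n, ε₀ ≤ ∫ x in Metric.ball (y n) R₀, ‖φ n x‖ ^ 2

/-- The best (smallest) constant `C_α` in
`‖u‖_{2α+2}^{2α+2} ≤ C_α ‖u‖₂^(8α-4) D[u]^(2-3α) ‖∇u‖₂^(6α-2)` for all `u ∈ H¹(ℝ³)`,
`1/2 ≤ α ≤ 2/3`. Recall that `mass u = ‖u‖₂²` and `gradSq u = ‖∇u‖₂²`. -/
def bestConst (𝕜 : Type*) [RCLike 𝕜] (α : ℝ) : ℝ :=
  sInf {K : ℝ | 0 < K ∧ ∀ u ∈ H1 𝕜,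
    powerInt α u ≤
      K * mass u ^ (4 * α - 2) * coulomb u ^ (2 - 3 * α) * gradSq u ^ (3 * α - 1)}

end XSP

end

noncomputable section

namespace XSP

open scoped ENNReal Convolution

/-! The value of `C` is critical: AM-GM and the best constant bound the negative term by `1/2 ‖∇u‖²
+ 1/4 D[u]`, with a perfect square to spare, so the energy is nonnegative on all of `H1`
(`energy_half_nonneg`). The mass-preserving dilations `s³ u(s² x)` send all three terms to `0`, so
`I_1 = 0` (`infEnergy_half_eq_zero`). Under `l² u(l x)` the energy is multiplied by `l³` and the
mass by `l`. Hence any nonzero `H1` function of zero energy, whatever its mass, rescales to a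
minimizer, and mass lost in a weak limit does no harm.

It remains to find such a function. A bound on the energy controls the gradient
(`exists_gradSq_le`), so the minimizing sequence, translated to the centres of the non-vanishing
balls, has a weak limit `v` in `H1`. Rellich's theorem on a fixed ball gives `v ≠ 0`. The energy
splits as `E[v] + E[u_n - v] ≤ E[u_n] + o(1)` (`exists_energy_splitting`). The right side tends to
`0` and `E[u_n - v] ≥ 0`, so `E[v] ≤ 0`, hence `E[v] = 0`.

Only this one-sided splitting is needed. The Coulomb cross terms are controlled by a uniform bound
on Newtonian potentials, and the cross terms in `L³` by local strong convergence and small tails of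
`v`. -/

/-! ### Mollification and translation estimates in `L²`. -/

theorem sq_eLpNorm_two {X F : Type*} [MeasurableSpace X] {μ : Measure X} [NormedAddCommGroup F]
    (f : X → F) : eLpNorm f 2 μ ^ 2 = ∫⁻ x, ‖f x‖ₑ ^ 2 ∂μ := by
  have := eLpNorm_nnreal_pow_eq_lintegral (f := f) (μ := μ) (p := 2) two_ne_zero
  simpa using this

theorem eLpNorm_two_le_iff {X F : Type*} [MeasurableSpace X] {μ : Measure X}
    [NormedAddCommGroup F] (f : X → F) (K : ℝ≥0∞) :
    eLpNorm f 2 μ ≤ K ↔ ∫⁻ x, ‖f x‖ₑ ^ 2 ∂μ ≤ K ^ 2 := by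
  rw [← sq_eLpNorm_two, ENNReal.pow_le_pow_left_iff two_ne_zero]

theorem sq_lintegral_le {T : Type*} [MeasurableSpace T] (ν : Measure T) [IsProbabilityMeasure ν]
    (f : T → ℝ≥0∞) : (∫⁻ t, f t ∂ν) ^ 2 ≤ ∫⁻ t, f t ^ 2 ∂ν := by
  -- Since `f` need not be measurable, Hölder is applied to a measurable minorant with the same
  -- integral.
  obtain ⟨g, hg, hgf, hfg⟩ := exists_measurable_le_lintegral_eq ν f
  rw [hfg]
  have h := ENNReal.lintegral_mul_le_Lp_mul_Lq ν Real.HolderConjugate.two_two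
    hg.aemeasurable (measurable_const (a := (1 : ℝ≥0∞))).aemeasurable
  simp only [Pi.mul_apply, mul_one, ENNReal.rpow_two, one_pow, lintegral_const, measure_univ,
    ENNReal.one_rpow] at h
  calc (∫⁻ t, g t ∂ν) ^ 2 ≤ ((∫⁻ t, g t ^ 2 ∂ν) ^ (1 / 2 : ℝ)) ^ 2 := by gcongr
    _ = ∫⁻ t, g t ^ 2 ∂ν := by
      rw [← ENNReal.rpow_two, ← ENNReal.rpow_mul]; norm_num
    _ ≤ _ := by gcongr with t; exact hgf t

/-- Minkowski's integral inequality in `L²`, against a probability measure. -/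
theorem lintegral_sq_lintegral_le {X T : Type*} [MeasurableSpace X] [MeasurableSpace T]
    {μ : Measure X} [SFinite μ] {ν : Measure T} [IsProbabilityMeasure ν] {F : X × T → ℝ≥0∞}
    (hF : AEMeasurable F (μ.prod ν)) {K : ℝ≥0∞}
    (hK : ∀ᵐ t ∂ν, ∫⁻ x, F (x, t) ^ 2 ∂μ ≤ K) :
    ∫⁻ x, (∫⁻ t, F (x, t) ∂ν) ^ 2 ∂μ ≤ K := by
  calc ∫⁻ x, (∫⁻ t, F (x, t) ∂ν) ^ 2 ∂μ ≤ ∫⁻ x, ∫⁻ t, F (x, t) ^ 2 ∂ν ∂μ := by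
        gcongr with x; exact sq_lintegral_le ν _
    _ = ∫⁻ t, ∫⁻ x, F (x, t) ^ 2 ∂μ ∂ν :=
        lintegral_lintegral_swap (f := fun x t => F (x, t) ^ 2) (hF.pow_const 2)
    _ ≤ ∫⁻ _, K ∂ν := lintegral_mono_ae hK
    _ = K := by simp

/-- The mollification of `u` by the normalized bump function `φ`. -/
def moll {𝕜 : Type*} [RCLike 𝕜] (φ : ContDiffBump (0 : R3)) (u : R3 → 𝕜) : R3 → 𝕜 :=
  φ.normed volume ⋆[ContinuousLinearMap.lsmul ℝ ℝ, volume] u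

/-- The probability measure with density the normalized bump function `φ`. -/
def bumpMeasure (φ : ContDiffBump (0 : R3)) : Measure R3 :=
  volume.withDensity fun x => ENNReal.ofReal (φ.normed volume x)

instance (φ : ContDiffBump (0 : R3)) : IsProbabilityMeasure (bumpMeasure φ) := by
  constructor
  rw [bumpMeasure, withDensity_apply _ MeasurableSet.univ, Measure.restrict_univ,
    ← ofReal_integral_eq_lintegral_ofReal φ.integrable_normed
      (Eventually.of_forall φ.nonneg_normed), φ.integral_normed, ENNReal.ofReal_one]

theorem ae_bumpMeasure_norm_lt (φ : ContDiffBump (0 : R3)) :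
    ∀ᵐ t ∂bumpMeasure φ, ‖t‖ < φ.rOut := by
  rw [bumpMeasure, ae_withDensity_iff (by
    have := φ.continuous_normed (μ := volume); fun_prop)]
  filter_upwards with t ht
  have : t ∈ Function.support (φ.normed volume) := fun h => ht (by simp [h])
  rw [φ.support_normed_eq] at this
  simpa using this

variable {𝕜 : Type*} [RCLike 𝕜]

theorem moll_eq_integral (φ : ContDiffBump (0 : R3)) (u : R3 → 𝕜) (x : R3) :
    moll φ u x = ∫ t, u (x - t) ∂bumpMeasure φ := by
  have hm := φ.continuous_normed (μ := volume)
  rw [bumpMeasure, integral_withDensity_eq_integral_toReal_smul (by fun_prop) (by simp)]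
  simp only [moll, convolution_def, ContinuousLinearMap.lsmul_apply]
  congr 1 with t
  rw [ENNReal.toReal_ofReal (φ.nonneg_normed t)]

theorem contDiff_moll (φ : ContDiffBump (0 : R3)) {u : R3 → 𝕜}
    (hu : LocallyIntegrable u volume) : ContDiff ℝ ∞ (moll φ u) :=
  φ.hasCompactSupport_normed.contDiff_convolution_left _ φ.contDiff_normed hu

theorem integrable_bumpMeasure (φ : ContDiffBump (0 : R3)) {u : R3 → 𝕜}
    (hu : LocallyIntegrable u volume) (x : R3) :
    Integrable (fun t => u (x - t)) (bumpMeasure φ) := by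
  have hm := φ.continuous_normed (μ := volume)
  have := (φ.hasCompactSupport_normed (μ := volume)).convolutionExists_left
    (ContinuousLinearMap.lsmul ℝ ℝ) hm hu x
  rw [bumpMeasure, integrable_withDensity_iff_integrable_smul' (by fun_prop) (by simp)]
  refine this.congr (Eventually.of_forall fun t => ?_)
  simp [ENNReal.toReal_ofReal (φ.nonneg_normed t)]

theorem aemeasurable_enorm_comp_sub {F : Type*} [NormedAddCommGroup F] {g : R3 → F}
    (hg : AEStronglyMeasurable g volume) (ν : Measure R3) [SFinite ν] :
    AEStronglyMeasurable (fun p : R3 × R3 => g (p.1 - p.2)) (volume.prod ν) :=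
  hg.comp_quasiMeasurePreserving (quasiMeasurePreserving_sub_of_right_invariant volume ν)

/-- A mollification is an average of translates against a probability measure, and translates have
equal norm. -/
theorem eLpNorm_moll_le (φ : ContDiffBump (0 : R3)) {g : R3 → 𝕜}
    (hg : AEStronglyMeasurable g volume) :
    eLpNorm (moll φ g) 2 volume ≤ eLpNorm g 2 volume := by
  rw [eLpNorm_two_le_iff]
  calc ∫⁻ x, ‖moll φ g x‖ₑ ^ 2 ≤ ∫⁻ x, (∫⁻ t, ‖g (x - t)‖ₑ ∂bumpMeasure φ) ^ 2 := by
        gcongr with x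
        rw [moll_eq_integral]
        exact enorm_integral_le_lintegral_enorm _
    _ ≤ _ := by
        refine lintegral_sq_lintegral_le (F := fun p : R3 × R3 => ‖g (p.1 - p.2)‖ₑ)
          (aemeasurable_enorm_comp_sub hg _).enorm (Eventually.of_forall fun t => ?_)
        rw [sq_eLpNorm_two]
        exact (lintegral_sub_right_eq_self (fun x => ‖g x‖ₑ ^ 2) t).le

/-- The derivative falls on the bump, and `t ↦ φ(x - t)` is an admissible test function. The sign
from the reflection cancels the one from integration by parts. -/
theorem hasWeakPartial_fderiv_moll (φ : ContDiffBump (0 : R3)) {u g : R3 → 𝕜} {i : Fin 3}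
    (hu : LocallyIntegrable u volume) (h : HasWeakPartial i u g) (x : R3) :
    fderiv ℝ (moll φ u) x (EuclideanSpace.single i 1) = moll φ g x := by
  have hc := φ.hasCompactSupport_normed (μ := volume)
  have hs : ContDiff ℝ 1 (φ.normed volume) := φ.contDiff_normed
  have hd := hc.hasFDerivAt_convolution_left (ContinuousLinearMap.lsmul ℝ ℝ : ℝ →L[ℝ] 𝕜 →L[ℝ] 𝕜)
    hs hu x
  have hη : ContDiff ℝ ∞ fun t => φ.normed volume (x - t) :=
    φ.contDiff_normed.comp (contDiff_const.sub contDiff_id)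
  have hηc : HasCompactSupport fun t => φ.normed volume (x - t) :=
    hc.comp_homeomorph (Homeomorph.subLeft x)
  have key := h _ hη hηc
  rw [moll, hd.fderiv, convolution_eq_swap, ContinuousLinearMap.integral_apply, moll,
    convolution_eq_swap]
  · simp only [ContinuousLinearMap.lsmul_apply] at key ⊢
    rw [← neg_eq_iff_eq_neg, ← integral_neg] at key
    rw [← key]
    congr 1 with t
    have : fderiv ℝ (fun t => φ.normed volume (x - t)) t
        = (fderiv ℝ (φ.normed volume) (x - t)).comp (-ContinuousLinearMap.id ℝ R3) := by
      refine HasFDerivAt.fderiv ?_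
      refine HasFDerivAt.comp t (hs.differentiable one_ne_zero (x - t)).hasFDerivAt ?_
      exact (hasFDerivAt_id t).const_sub x
    simp [this, ContinuousLinearMap.precompL_apply]
  · exact ((hc.fderiv ℝ).convolutionExists_left _ (hs.continuous_fderiv one_ne_zero) hu
      x).integrable_swap

theorem opNorm_le_sum {F : Type*} [NormedAddCommGroup F] [NormedSpace ℝ F] (L : R3 →L[ℝ] F) :
    ‖L‖ ≤ ∑ i : Fin 3, ‖L (EuclideanSpace.single i 1)‖ := by
  refine L.opNorm_le_bound (by positivity) fun x => ?_
  have hx : x = ∑ i : Fin 3, x i • EuclideanSpace.single i (1 : ℝ) := by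
    ext j; fin_cases j <;> simp [Fin.sum_univ_three]
  conv_lhs => rw [hx, map_sum]
  refine (norm_sum_le _ _).trans ?_
  rw [Finset.sum_mul]
  refine Finset.sum_le_sum fun i _ => ?_
  rw [map_smul, norm_smul, mul_comm]
  gcongr
  exact PiLp.norm_apply_le x i

theorem eLpNorm_fderiv_le {F : Type*} [NormedAddCommGroup F] [NormedSpace ℝ F] {v : R3 → F}
    (hv : ContDiff ℝ 1 v) :
    eLpNorm (fderiv ℝ v) 2 volume ≤
      ∑ i : Fin 3, eLpNorm (fun x => fderiv ℝ v x (EuclideanSpace.single i 1)) 2 volume := by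
  have hc := hv.continuous_fderiv one_ne_zero
  calc eLpNorm (fderiv ℝ v) 2 volume
      ≤ eLpNorm (fun x => ∑ i : Fin 3, ‖fderiv ℝ v x (EuclideanSpace.single i 1)‖) 2 volume :=
        eLpNorm_mono_real fun x => opNorm_le_sum _
    _ ≤ ∑ i : Fin 3,
        eLpNorm (fun x => ‖fderiv ℝ v x (EuclideanSpace.single i 1)‖) 2 volume := by
        have := eLpNorm_sum_le (μ := volume) (p := 2) (s := Finset.univ)
          (f := fun (i : Fin 3) x => ‖fderiv ℝ v x (EuclideanSpace.single i 1)‖)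
          (fun i _ => Continuous.aestronglyMeasurable (by fun_prop)) (by norm_num)
        convert this using 2
        ext x; simp
    _ = _ := by simp only [eLpNorm_norm]

theorem eLpNorm_fderiv_moll_le (φ : ContDiffBump (0 : R3)) {u : R3 → 𝕜} (hu : u ∈ H1 𝕜) :
    eLpNorm (fderiv ℝ (moll φ u)) 2 volume ≤ ∑ i : Fin 3, eLpNorm (weakPartial i u) 2 volume := by
  have hl := hu.1.locallyIntegrable (by norm_num)
  refine (eLpNorm_fderiv_le ((contDiff_moll φ hl).of_le (by norm_cast))).trans ?_
  refine Finset.sum_le_sum fun i _ => ?_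
  have h := weakPartial_spec (hu.2 i)
  simp only [hasWeakPartial_fderiv_moll φ hl h.2]
  exact eLpNorm_moll_le φ h.1.1

/-- A sequence of bump functions concentrating at the origin. -/
def bumpSeq (n : ℕ) : ContDiffBump (0 : R3) where
  rIn := 1 / (n + 1) / 2
  rOut := 1 / (n + 1)
  rIn_pos := by positivity
  rIn_lt_rOut := half_lt_self (by positivity)

theorem ae_tendsto_moll {u : R3 → 𝕜} (hu : LocallyIntegrable u volume) :
    ∀ᵐ x, Tendsto (fun n => moll (bumpSeq n) u x) atTop (𝓝 (u x)) := by
  refine ContDiffBump.ae_convolution_tendsto_right_of_locallyIntegrable (K := 2)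
    tendsto_one_div_add_atTop_nhds_zero_nat (Eventually.of_forall fun n => ?_) hu
  simp only [bumpSeq]
  linarith

/-- The fundamental theorem of calculus along the segment from `x - h` to `x`, then Minkowski in the
segment parameter and translation invariance. -/
theorem lintegral_sq_sub_translate_le_of_contDiff {v : R3 → 𝕜} (hv : ContDiff ℝ 1 v) (h : R3) :
    ∫⁻ x, ‖v x - v (x - h)‖ₑ ^ 2 ≤ (‖h‖ₑ * eLpNorm (fderiv ℝ v) 2 volume) ^ 2 := by
  have hc := hv.continuous_fderiv one_ne_zero
  have key (x : R3) : ‖v x - v (x - h)‖ₑ ≤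
      ∫⁻ s in Set.Ioc (0 : ℝ) 1, ‖h‖ₑ * ‖fderiv ℝ v (x - h + s • h)‖ₑ := by
    have h1 : v x - v (x - h) = ∫ s in (0 : ℝ)..1, fderiv ℝ v (x - h + s • h) h := by
      rw [intervalIntegral.integral_eq_sub_of_hasDerivAt (f := fun s : ℝ => v (x - h + s • h))]
      · simp
      · intro s _
        have := (hv.differentiable one_ne_zero (x - h + s • h)).hasFDerivAt
        refine this.comp_hasDerivAt s ?_
        simpa using ((hasDerivAt_id s).smul_const h).const_add (x - h)
      · exact Continuous.intervalIntegrable (by fun_prop) _ _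
    rw [h1, intervalIntegral.integral_of_le zero_le_one]
    refine (enorm_integral_le_lintegral_enorm _).trans ?_
    gcongr with s
    rw [mul_comm]
    exact ContinuousLinearMap.le_opENorm _ _
  have : IsProbabilityMeasure (volume.restrict (Set.Ioc (0 : ℝ) 1)) := ⟨by simp⟩
  calc _ ≤ ∫⁻ x, (∫⁻ s in Set.Ioc (0 : ℝ) 1, ‖h‖ₑ * ‖fderiv ℝ v (x - h + s • h)‖ₑ) ^ 2 := by
        gcongr with x; exact key x
    _ ≤ _ := by
        refine lintegral_sq_lintegral_le
          (F := fun p : R3 × ℝ => ‖h‖ₑ * ‖fderiv ℝ v (p.1 - h + p.2 • h)‖ₑ) ?_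
          (Eventually.of_forall fun s => ?_)
        · refine Continuous.aemeasurable ?_
          refine ENNReal.continuous_const_mul (by simp) |>.comp ?_
          fun_prop
        · simp only [mul_pow]
          rw [lintegral_const_mul' _ _ (by simp), sq_eLpNorm_two]
          refine mul_le_mul_right ?_ _
          have := lintegral_add_right_eq_self (μ := (volume : Measure R3))
            (fun x => ‖fderiv ℝ v x‖ₑ ^ 2) (-h + s • h)
          simp only [← add_assoc, ← sub_eq_add_neg] at this
          exact this.le

/-- The smooth case applied to mollifications, whose gradients are bounded by that of `u`; Fatou
passes to the limit. -/
theorem lintegral_sq_sub_translate_le {u : R3 → 𝕜} (hu : u ∈ H1 𝕜) (h : R3) :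
    ∫⁻ x, ‖u x - u (x - h)‖ₑ ^ 2 ≤
      (‖h‖ₑ * ∑ i : Fin 3, eLpNorm (weakPartial i u) 2 volume) ^ 2 := by
  have hl := hu.1.locallyIntegrable (by norm_num)
  have ha := ae_tendsto_moll hl
  have hb : ∀ᵐ x, Tendsto (fun n => moll (bumpSeq n) u (x - h)) atTop (𝓝 (u (x - h))) :=
    (measurePreserving_sub_right volume h).quasiMeasurePreserving.ae ha
  have hs n : ContDiff ℝ 1 (moll (bumpSeq n) u) :=
    (contDiff_moll _ hl).of_le (by norm_cast)
  calc ∫⁻ x, ‖u x - u (x - h)‖ₑ ^ 2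
      = ∫⁻ x, liminf (fun n => ‖moll (bumpSeq n) u x - moll (bumpSeq n) u (x - h)‖ₑ ^ 2) atTop := by
        refine lintegral_congr_ae ?_
        filter_upwards [ha, hb] with x h1 h2
        exact (((ENNReal.continuous_pow 2).tendsto _).comp (h1.sub h2).enorm).liminf_eq.symm
    _ ≤ liminf (fun n => ∫⁻ x, ‖moll (bumpSeq n) u x - moll (bumpSeq n) u (x - h)‖ₑ ^ 2) atTop := by
        refine lintegral_liminf_le fun n => ?_
        have := (hs n).continuous
        exact Continuous.measurable (by fun_prop)
    _ ≤ _ := by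
        refine liminf_le_of_le (by isBoundedDefault) fun b hb => ?_
        obtain ⟨n, hn⟩ := hb.exists
        refine hn.trans ((lintegral_sq_sub_translate_le_of_contDiff (hs n) h).trans ?_)
        gcongr
        exact eLpNorm_fderiv_moll_le _ hu

/-- The difference is the average of `u - u(· - t)` over `‖t‖ < φ.rOut`. The rate depends on `u`
only through its gradient, which is what makes Rellich's theorem uniform along a sequence. -/
theorem eLpNorm_sub_moll_le (φ : ContDiffBump (0 : R3)) {u : R3 → 𝕜} (hu : u ∈ H1 𝕜) :
    eLpNorm (u - moll φ u) 2 volume ≤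
      ENNReal.ofReal φ.rOut * ∑ i : Fin 3, eLpNorm (weakPartial i u) 2 volume := by
  have hl := hu.1.locallyIntegrable (by norm_num)
  rw [eLpNorm_two_le_iff]
  calc ∫⁻ x, ‖(u - moll φ u) x‖ₑ ^ 2
      ≤ ∫⁻ x, (∫⁻ t, ‖u x - u (x - t)‖ₑ ∂bumpMeasure φ) ^ 2 := by
        gcongr with x
        have : (u - moll φ u) x = ∫ t, (u x - u (x - t)) ∂bumpMeasure φ := by
          rw [integral_sub (integrable_const _) (integrable_bumpMeasure φ hl x),
            ← moll_eq_integral]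
          simp
        rw [this]
        exact enorm_integral_le_lintegral_enorm _
    _ ≤ _ := by
        refine lintegral_sq_lintegral_le (F := fun p : R3 × R3 => ‖u p.1 - u (p.1 - p.2)‖ₑ)
          (hu.1.1.comp_fst.sub (aemeasurable_enorm_comp_sub hu.1.1 _)).enorm ?_
        filter_upwards [ae_bumpMeasure_norm_lt φ] with t ht
        refine (lintegral_sq_sub_translate_le hu t).trans ?_
        gcongr
        rw [← ofReal_norm]
        exact ENNReal.ofReal_le_ofReal ht.le

/-! ### The Sobolev embedding. -/

/-- The bound is uniform in `s ≤ 1`, so the cutoff can be spread out to all of space at a fixed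
cost. -/
theorem norm_fderiv_cutoff_smul_le {χ : R3 → ℝ} (hχ : ContDiff ℝ 1 χ) (hχ0 : ∀ x, 0 ≤ χ x)
    (hχ1 : ∀ x, χ x ≤ 1) {c : ℝ}
    (hc : ∀ x, ‖fderiv ℝ χ x‖ ≤ c) {v : R3 → 𝕜} (hv : ContDiff ℝ 1 v) {s : ℝ} (hs : 0 ≤ s)
    (hs1 : s ≤ 1) (x : R3) :
    ‖fderiv ℝ (fun x => χ (s • x) • v x) x‖ ≤ ‖fderiv ℝ v x‖ + c * ‖v x‖ := by
  have h1 : HasFDerivAt (fun x : R3 => χ (s • x))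
      ((fderiv ℝ χ (s • x)).comp (s • ContinuousLinearMap.id ℝ R3)) x := by
    exact (hχ.differentiable one_ne_zero (s • x)).hasFDerivAt.comp x
      ((hasFDerivAt_id x).const_smul s)
  have h2 := (hv.differentiable one_ne_zero x).hasFDerivAt
  rw [HasFDerivAt.fderiv (f := fun x => χ (s • x) • v x) (h1.smul h2)]
  refine (norm_add_le _ _).trans (add_le_add ?_ ?_)
  · rw [norm_smul, Real.norm_of_nonneg (hχ0 _)]
    exact mul_le_of_le_one_left (norm_nonneg _) (hχ1 _)
  · refine ContinuousLinearMap.opNorm_le_bound _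
      (mul_nonneg ((norm_nonneg _).trans (hc 0)) (norm_nonneg _)) fun y => ?_
    simp only [ContinuousLinearMap.smulRight_apply, ContinuousLinearMap.comp_apply,
      smul_apply, ContinuousLinearMap.id_apply, map_smul, norm_smul,
      Real.norm_of_nonneg hs, smul_eq_mul, norm_mul]
    have h3 : ‖fderiv ℝ χ (s • x) y‖ ≤ c * ‖y‖ :=
      (ContinuousLinearMap.le_opNorm _ _).trans (by gcongr; exact hc _)
    calc s * ‖fderiv ℝ χ (s • x) y‖ * ‖v x‖ ≤ 1 * (c * ‖y‖) * ‖v x‖ := by gcongr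
      _ = c * ‖v x‖ * ‖y‖ := by ring

/-- The Sobolev embedding of `H¹(ℝ³)` into `L⁶(ℝ³)`. -/
theorem exists_eLpNorm_six_le (𝕜 : Type*) [RCLike 𝕜] : ∃ S : NNReal, ∀ u ∈ H1 𝕜,
    eLpNorm u 6 volume ≤
      S * (eLpNorm u 2 volume + ∑ i : Fin 3, eLpNorm (weakPartial i u) 2 volume) := by
  let χ : ContDiffBump (0 : R3) := ⟨1, 2, one_pos, one_lt_two⟩
  have hχ1 : ContDiff ℝ 1 χ := χ.contDiff
  obtain ⟨c, hc⟩ := (χ.hasCompactSupport.fderiv ℝ).exists_bound_of_continuous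
    (hχ1.continuous_fderiv one_ne_zero)
  have hc0 : 0 ≤ c := (norm_nonneg _).trans (hc 0)
  let c' : NNReal := ⟨c, hc0⟩
  let S₀ := SNormLESNormFDerivOfEqConst 𝕜 (volume : Measure R3) 2
  refine ⟨S₀ * (1 + c'), fun u hu => ?_⟩
  have hl := hu.1.locallyIntegrable (by norm_num)
  have hsm n : ContDiff ℝ 1 (moll (bumpSeq n) u) :=
    (contDiff_moll _ hl).of_le (by norm_cast)
  let s : ℕ → ℝ := fun n => 1 / ((n : ℝ) + 1)
  have hs0 n : 0 < s n := by positivity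
  have hs1 n : s n ≤ 1 := by
    simp only [s]; rw [div_le_one (by positivity)]; linarith [n.cast_nonneg (α := ℝ)]
  -- The Gagliardo-Nirenberg-Sobolev inequality requires compactly supported `C¹` functions, so `u`
  -- is mollified and cut off at a radius of order `n + 1`. Almost everywhere convergence and Fatou
  -- then recover `u`.
  let v : ℕ → R3 → 𝕜 := fun n x => χ (s n • x) • moll (bumpSeq n) u x
  have hv n : ContDiff ℝ 1 (v n) :=
    (hχ1.comp (contDiff_const_smul (s n))).smul (hsm n)
  have hvc n : HasCompactSupport (v n) := by
    refine HasCompactSupport.smul_right (f := fun x => χ (s n • x)) ?_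
    exact χ.hasCompactSupport.comp_smul (hs0 n).ne'
  have hlim : ∀ᵐ x, Tendsto (fun n => v n x) atTop (𝓝 (u x)) := by
    filter_upwards [ae_tendsto_moll hl] with x hx
    have h1 : Tendsto (fun n => χ (s n • x)) atTop (𝓝 1) := by
      have : Tendsto (fun n => s n • x) atTop (𝓝 ((0 : ℝ) • x)) :=
        tendsto_one_div_add_atTop_nhds_zero_nat.smul_const x
      rw [zero_smul] at this
      have h := (χ.continuous.tendsto 0).comp this
      rwa [χ.one_of_mem_closedBall (by simp [χ])] at h
    simpa using h1.smul hx
  refine (Lp.eLpNorm_lim_le_liminf_eLpNorm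
    (fun n => (hv n).continuous.aestronglyMeasurable) u hlim).trans ?_
  refine liminf_le_of_le (by isBoundedDefault) fun b hb => ?_
  obtain ⟨n, hn⟩ := hb.exists
  refine hn.trans ?_
  have hfin : Module.finrank ℝ R3 = 3 := by simp
  have hS := eLpNorm_le_eLpNorm_fderiv_of_eq (volume : Measure R3) (hv n) (hvc n)
    (p := 2) (p' := 6) (by norm_num) (by rw [hfin]; norm_num) (by rw [hfin]; norm_num)
  refine hS.trans ?_
  have hd : eLpNorm (fderiv ℝ (v n)) 2 volume ≤
      eLpNorm (fderiv ℝ (moll (bumpSeq n) u)) 2 volume +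
        ENNReal.ofReal c * eLpNorm (moll (bumpSeq n) u) 2 volume := by
    have hcf := (hsm n).continuous_fderiv one_ne_zero
    have hcm := (hsm n).continuous
    calc eLpNorm (fderiv ℝ (v n)) 2 volume
        ≤ eLpNorm ((fun x => ‖fderiv ℝ (moll (bumpSeq n) u) x‖) +
            c • fun x => ‖moll (bumpSeq n) u x‖) 2 volume :=
          eLpNorm_mono_real fun x =>
            norm_fderiv_cutoff_smul_le hχ1 (fun _ => χ.nonneg) (fun _ => χ.le_one) hc
              (hsm n) (hs0 n).le (hs1 n) x
      _ ≤ _ := by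
          refine (eLpNorm_add_le (Continuous.aestronglyMeasurable (by fun_prop))
            (Continuous.aestronglyMeasurable (by fun_prop)) (by norm_num)).trans ?_
          rw [eLpNorm_const_smul, eLpNorm_norm, eLpNorm_norm, Real.enorm_of_nonneg hc0]
  have hcc : ENNReal.ofReal c = (c' : ℝ≥0∞) :=
    ENNReal.ofReal_eq_coe_nnreal hc0
  calc (S₀ : ℝ≥0∞) * eLpNorm (fderiv ℝ (v n)) 2 volume
      ≤ S₀ * (∑ i : Fin 3, eLpNorm (weakPartial i u) 2 volume +
          (c' : ℝ≥0∞) * eLpNorm u 2 volume) := by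
        rw [← hcc]
        gcongr
        refine hd.trans ?_
        gcongr
        · exact eLpNorm_fderiv_moll_le _ hu
        · exact eLpNorm_moll_le _ hu.1.1
    _ ≤ _ := by
        rw [ENNReal.coe_mul, mul_assoc]
        gcongr
        rw [ENNReal.coe_add, add_mul, ENNReal.coe_one, one_mul, mul_add]
        calc _ ≤ (∑ i : Fin 3, eLpNorm (weakPartial i u) 2 volume) +
              (c' : ℝ≥0∞) * eLpNorm u 2 volume + (eLpNorm u 2 volume +
              (c' : ℝ≥0∞) * ∑ i : Fin 3, eLpNorm (weakPartial i u) 2 volume) :=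
              le_self_add
          _ = _ := by ring

/-! ### Real-valued moment bounds and coercivity of the energy. -/

theorem toReal_eLpNorm_pow {X F : Type*} [MeasurableSpace X] {μ : Measure X}
    [NormedAddCommGroup F] {f : X → F} {n : ℕ} (hn : n ≠ 0) (hf : MemLp f n μ) :
    (eLpNorm f n μ).toReal ^ n = ∫ x, ‖f x‖ ^ n ∂μ := by
  have h := eLpNorm_nnreal_pow_eq_lintegral (f := f) (μ := μ) (p := n) (by exact_mod_cast hn)
  have h2 := hf.integrable_norm_pow hn
  simp only [NNReal.coe_natCast, ENNReal.rpow_natCast, ENNReal.coe_natCast] at h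
  rw [← ENNReal.toReal_pow, h, integral_eq_lintegral_of_nonneg_ae
    (Eventually.of_forall fun x => by positivity) h2.1]
  congr 2 with x
  rw [ENNReal.ofReal_pow (norm_nonneg _), ofReal_norm]

theorem gradSq_eq_sum {u : R3 → 𝕜} (hu : u ∈ H1 𝕜) :
    gradSq u = ∑ i : Fin 3, ∫ x, ‖weakPartial i u x‖ ^ 2 := by
  rw [gradSq, integral_finsetSum]
  exact fun i _ => MemLp.integrable_norm_pow (p := 2) (weakPartial_spec (hu.2 i)).1 two_ne_zero

theorem mass_nonneg (u : R3 → 𝕜) : 0 ≤ mass u := integral_nonneg fun x => by positivity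

theorem gradSq_nonneg (u : R3 → 𝕜) : 0 ≤ gradSq u := integral_nonneg fun x => by positivity

theorem coulomb_nonneg (u : R3 → 𝕜) : 0 ≤ coulomb u := integral_nonneg fun x => by positivity

theorem memLp_six {u : R3 → 𝕜} (hu : u ∈ H1 𝕜) : MemLp u 6 volume := by
  obtain ⟨S, hS⟩ := exists_eLpNorm_six_le 𝕜
  refine ⟨hu.1.1, (hS u hu).trans_lt (ENNReal.mul_lt_top ENNReal.coe_lt_top ?_)⟩
  refine ENNReal.add_lt_top.2 ⟨hu.1.2, ENNReal.sum_lt_top.2 fun i _ => ?_⟩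
  exact (weakPartial_spec (hu.2 i)).1.2

theorem exists_integral_pow_six_le (𝕜 : Type*) [RCLike 𝕜] : ∃ K : ℝ, 0 ≤ K ∧ ∀ u ∈ H1 𝕜,
    ∫ x, ‖u x‖ ^ 6 ≤ K * (mass u + gradSq u) ^ 3 := by
  obtain ⟨S, hS⟩ := exists_eLpNorm_six_le 𝕜
  -- The factor `4` is the Cauchy-Schwarz constant for a sum of four norms, cubed in passing from
  -- squares to sixth powers.
  refine ⟨S ^ 6 * 4 ^ 3, by positivity, fun u hu => ?_⟩
  have h6 := toReal_eLpNorm_pow (n := 6) (by norm_num) (memLp_six hu)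
  have h2 := toReal_eLpNorm_pow (n := 2) (by norm_num) hu.1
  have hi i := toReal_eLpNorm_pow (n := 2) (by norm_num) (weakPartial_spec (hu.2 i)).1
  have hfin i : eLpNorm (weakPartial i u) 2 volume ≠ ⊤ := (weakPartial_spec (hu.2 i)).1.2.ne
  have hR := ENNReal.toReal_mono (ENNReal.mul_ne_top ENNReal.coe_ne_top
    (ENNReal.add_ne_top.2 ⟨hu.1.2.ne, ENNReal.sum_ne_top.2 fun i _ => hfin i⟩)) (hS u hu)
  rw [ENNReal.toReal_mul, ENNReal.toReal_add hu.1.2.ne (ENNReal.sum_ne_top.2 fun i _ => hfin i),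
    ENNReal.toReal_sum (fun i _ => hfin i), ENNReal.coe_toReal] at hR
  push_cast at h6 h2 hi
  rw [mass, gradSq_eq_sum hu, ← h6, ← h2]
  simp only [← hi, Fin.sum_univ_three] at hR ⊢
  set a := (eLpNorm u 2 volume).toReal
  set b := (eLpNorm (weakPartial 0 u) 2 volume).toReal
  set c := (eLpNorm (weakPartial 1 u) 2 volume).toReal
  set d := (eLpNorm (weakPartial 2 u) 2 volume).toReal
  have hsq : (a + (b + c + d)) ^ 2 ≤ 4 * (a ^ 2 + (b ^ 2 + c ^ 2 + d ^ 2)) := by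
    nlinarith [sq_nonneg (a - b), sq_nonneg (a - c), sq_nonneg (a - d), sq_nonneg (b - c),
      sq_nonneg (b - d), sq_nonneg (c - d)]
  calc (eLpNorm u 6 volume).toReal ^ 6 ≤ (S * (a + (b + c + d))) ^ 6 := by gcongr
    _ = S ^ 6 * ((a + (b + c + d)) ^ 2) ^ 3 := by ring
    _ ≤ S ^ 6 * (4 * (a ^ 2 + (b ^ 2 + c ^ 2 + d ^ 2))) ^ 3 := by gcongr
    _ = _ := by ring

theorem integrable_norm_pow_six {u : R3 → 𝕜} (hu : u ∈ H1 𝕜) :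
    Integrable (fun x => ‖u x‖ ^ 6) volume :=
  MemLp.integrable_norm_pow (p := 6) (memLp_six hu) (by norm_num)

theorem integrable_norm_sq {u : R3 → 𝕜} (hu : MemLp u 2 volume) :
    Integrable (fun x => ‖u x‖ ^ 2) volume :=
  MemLp.integrable_norm_pow (p := 2) hu (by norm_num)

theorem integrable_norm_pow_three {u : R3 → 𝕜} (hu : u ∈ H1 𝕜) :
    Integrable (fun x => ‖u x‖ ^ 3) volume := by
  refine ((integrable_norm_sq hu.1).add (integrable_norm_pow_six hu)).mono'
    (hu.1.1.norm.pow 3) (Eventually.of_forall fun x => ?_)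
  have := norm_nonneg (u x)
  rw [Real.norm_of_nonneg (by positivity), Pi.add_apply]
  nlinarith [sq_nonneg (‖u x‖ ^ 3 - 1 / 2 * ‖u x‖), sq_nonneg (‖u x‖ - 1),
    sq_nonneg (‖u x‖ ^ 2 - ‖u x‖), sq_nonneg (‖u x‖ ^ 3 - ‖u x‖)]

theorem integrable_norm_pow_four {u : R3 → 𝕜} (hu : u ∈ H1 𝕜) :
    Integrable (fun x => ‖u x‖ ^ 4) volume := by
  refine ((integrable_norm_sq hu.1).add (integrable_norm_pow_six hu)).mono'
    (hu.1.1.norm.pow 4) (Eventually.of_forall fun x => ?_)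
  rw [Real.norm_of_nonneg (by positivity), Pi.add_apply]
  nlinarith [sq_nonneg (‖u x‖ ^ 3 - ‖u x‖), sq_nonneg (‖u x‖), sq_nonneg (‖u x‖ ^ 3)]

theorem powerInt_half (u : R3 → 𝕜) : powerInt (1 / 2) u = ∫ x, ‖u x‖ ^ 3 := by
  simp only [powerInt]
  congr 1 with x
  rw [← Real.rpow_natCast]; norm_num

/-- Split according to `‖u x‖ ≤ K` or not. The free parameter `K` replaces interpolation between
`L²` and `L⁶`. -/
theorem powerInt_half_le {u : R3 → 𝕜} (hu : u ∈ H1 𝕜) {K : ℝ} (hK : 0 < K) :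
    powerInt (1 / 2) u ≤ K * mass u + (∫ x, ‖u x‖ ^ 6) / K ^ 3 := by
  have h2 := integrable_norm_sq hu.1
  have h6 := integrable_norm_pow_six hu
  rw [powerInt_half, mass, ← integral_const_mul, ← integral_div,
    ← integral_add (h2.const_mul K) (h6.div_const _)]
  refine integral_mono (integrable_norm_pow_three hu) ((h2.const_mul K).add (h6.div_const _))
    fun x => ?_
  beta_reduce
  set t := ‖u x‖
  have ht : 0 ≤ t := norm_nonneg _
  rcases le_total t K with h | h
  · have : t ^ 3 ≤ K * t ^ 2 := by nlinarith [sq_nonneg t]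
    have : 0 ≤ t ^ 6 / K ^ 3 := by positivity
    linarith
  · have : t ^ 3 ≤ t ^ 6 / K ^ 3 := by
      rw [le_div_iff₀ (by positivity), show t ^ 6 = t ^ 3 * t ^ 3 by ring]
      gcongr
    have : 0 ≤ K * t ^ 2 := by positivity
    linarith

/-- On `H¹` functions of unit mass, a bound on the energy bounds the Dirichlet integral. -/
theorem exists_gradSq_le (𝕜 : Type*) [RCLike 𝕜] {C : ℝ} (hC : 0 ≤ C) : ∃ B : ℝ, ∀ u ∈ H1 𝕜,
    mass u = 1 → energy (1 / 2) C u ≤ 1 → gradSq u ≤ B := by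
  obtain ⟨K, hK, h6⟩ := exists_integral_pow_six_le 𝕜
  refine ⟨(3 + 2 * (C / 3 * (1 + K))) ^ 4, fun u hu hm hE => ?_⟩
  have hG := gradSq_nonneg u
  set G := gradSq u
  -- With splitting height `γ ^ 3` both terms of the bound have order `γ ^ 3`, so the cubic integral
  -- grows at most like `G ^ (3/4)` and cannot compensate the Dirichlet term.
  set γ := (1 + G) ^ (1 / 4 : ℝ)
  have hγ4 : γ ^ 4 = 1 + G := by
    rw [← Real.rpow_natCast, ← Real.rpow_mul (by linarith)]; norm_num
  have hγ1 : 1 ≤ γ := Real.one_le_rpow (by linarith) (by norm_num)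
  have hP := powerInt_half_le hu (K := γ ^ 3) (by positivity)
  have h6u := h6 u hu
  rw [hm, ← hγ4] at h6u
  have hP2 : powerInt (1 / 2) u ≤ (1 + K) * γ ^ 3 := by
    calc powerInt (1 / 2) u ≤ γ ^ 3 * mass u + (∫ x, ‖u x‖ ^ 6) / (γ ^ 3) ^ 3 := hP
      _ ≤ γ ^ 3 * 1 + (K * (γ ^ 4) ^ 3) / (γ ^ 3) ^ 3 := by rw [hm]; gcongr
      _ = (1 + K) * γ ^ 3 := by field_simp
  have hD := coulomb_nonneg u
  have hE2 : 1 / 2 * G - C / 3 * powerInt (1 / 2) u ≤ 1 := by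
    rw [energy, show (2 * (1 / 2) + 2 : ℝ) = 3 by norm_num] at hE
    linarith
  have h3 : γ ^ 4 ≤ (3 + 2 * (C / 3 * (1 + K))) * γ ^ 3 := by
    have := mul_le_mul_of_nonneg_left hP2 (show 0 ≤ C / 3 by positivity)
    have : 1 ≤ γ ^ 3 := one_le_pow₀ hγ1
    nlinarith
  have h4 : γ ≤ 3 + 2 * (C / 3 * (1 + K)) := by
    by_contra! h
    have : 0 < γ ^ 3 := by positivity
    nlinarith
  have : γ ^ 4 ≤ (3 + 2 * (C / 3 * (1 + K))) ^ 4 := by gcongr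
  linarith

/-! ### Newtonian potentials and the Coulomb energy. -/

/-- The Newtonian potential of `f` exists everywhere and is bounded by `V`. -/
def HasPotentialBound (f : R3 → ℝ) (V : ℝ) : Prop :=
  ∀ x, Integrable (fun y => f y / ‖x - y‖) volume ∧ ∫ y, f y / ‖x - y‖ ≤ V

theorem HasPotentialBound.add {f g : R3 → ℝ} {V W : ℝ} (hf : HasPotentialBound f V)
    (hg : HasPotentialBound g W) : HasPotentialBound (fun x => f x + g x) (V + W) := by
  intro x
  simp only [add_div]
  refine ⟨(hf x).1.add (hg x).1, ?_⟩
  rw [integral_add (hf x).1 (hg x).1]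
  exact add_le_add (hf x).2 (hg x).2

/-- The integral of `|y|⁻²` over the unit ball. -/
def ballConst : ℝ := ∫ y in Metric.ball (0 : R3) 1, (‖y‖ ^ 2)⁻¹

theorem integrableOn_norm_sq_inv :
    IntegrableOn (fun y : R3 => (‖y‖ ^ 2)⁻¹) (Metric.ball 0 1) volume := by
  refine integrableOn_ball_of_norm_le_rpow (C := 1) (α := 2) (by simp) (by simp; norm_num)
    (Eventually.of_forall fun x => ?_) (Measurable.aestronglyMeasurable (by fun_prop))
  rw [Real.norm_of_nonneg (by positivity), one_mul, Real.rpow_neg (norm_nonneg _)]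
  norm_cast

/-- Near `x`, Young's inequality separates `‖u‖ ^ 4 ≤ ‖u‖ ^ 2 + ‖u‖ ^ 6` from the square of the
kernel, which is locally integrable in dimension three; at distance at least `1` the kernel is at
most `1`. The bound does not depend on `x`. -/
theorem hasPotentialBound_norm_sq {u : R3 → 𝕜} (hu : u ∈ H1 𝕜) :
    HasPotentialBound (fun x => ‖u x‖ ^ 2) (mass u + (∫ x, ‖u x‖ ^ 6) + ballConst) := by
  intro x
  have h2 := integrable_norm_sq hu.1
  have h6 := integrable_norm_pow_six hu
  let k : R3 → ℝ := (Metric.ball (0 : R3) 1).indicator fun y => (‖y‖ ^ 2)⁻¹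
  have hk : Integrable k volume :=
    integrableOn_norm_sq_inv.integrable_indicator Metric.isOpen_ball.measurableSet
  have hkx : Integrable (fun y => k (x - y)) volume := hk.comp_sub_left x
  have hkint : ∫ y, k (x - y) = ballConst := by
    rw [integral_sub_left_eq_self k, integral_indicator Metric.isOpen_ball.measurableSet,
      ballConst]
  have hpt (y : R3) : ‖u y‖ ^ 2 / ‖x - y‖ ≤ ‖u y‖ ^ 2 + ‖u y‖ ^ 6 + k (x - y) := by
    have ht := norm_nonneg (u y)
    set t := ‖u y‖
    set r := ‖x - y‖ with hr
    rcases lt_or_ge r 1 with h1 | h1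
    · have : k (x - y) = (r⁻¹) ^ 2 := by
        simp only [k]
        rw [Set.indicator_of_mem (by simpa using h1), inv_pow]
      rw [this, div_eq_mul_inv]
      nlinarith [sq_nonneg (t ^ 2 - r⁻¹), sq_nonneg (t ^ 3 - t), sq_nonneg t,
        sq_nonneg (t ^ 3), sq_nonneg r⁻¹]
    · have hk0 : 0 ≤ k (x - y) := Set.indicator_nonneg (fun y _ => by positivity) _
      have : t ^ 2 / r ≤ t ^ 2 := div_le_self (by positivity) h1
      have : 0 ≤ t ^ 6 := by positivity
      linarith
  have hint := (h2.add h6).add hkx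
  have hi : Integrable (fun y => ‖u y‖ ^ 2 / ‖x - y‖) volume := by
    refine hint.mono' ?_ (Eventually.of_forall fun y => ?_)
    · have : AEMeasurable (fun y => ‖u y‖ ^ 2) volume := h2.1.aemeasurable
      exact (this.div (by fun_prop)).aestronglyMeasurable
    · rw [Real.norm_of_nonneg (by positivity)]
      exact hpt y
  refine ⟨hi, (integral_mono hi hint hpt).trans (le_of_eq ?_)⟩
  have e1 := integral_add (h2.add h6) hkx
  have e2 := integral_add h2 h6
  simp only [Pi.add_apply] at e1 e2 ⊢
  rw [e1, e2, hkint, mass]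

/-- Tonelli: integrating in the second variable first leaves `g` times a potential bounded by `V`.
-/
theorem integrable_coulomb_prod {f g : R3 → ℝ} {V : ℝ} (hg : Integrable g volume) (hg0 : 0 ≤ g)
    (hf : HasPotentialBound f V) (hfm : AEStronglyMeasurable f volume) (hf0 : 0 ≤ f) :
    Integrable (fun p : R3 × R3 => g p.1 * f p.2 / ‖p.1 - p.2‖) volume ∧
      ∫ p : R3 × R3, g p.1 * f p.2 / ‖p.1 - p.2‖ ≤ V * ∫ x, g x := by
  have hm : AEStronglyMeasurable (fun p : R3 × R3 => g p.1 * f p.2 / ‖p.1 - p.2‖)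
      (volume.prod volume) := by
    have h1 : AEMeasurable (fun p : R3 × R3 => g p.1 * f p.2) (volume.prod volume) :=
      (hg.1.comp_fst.mul hfm.comp_snd).aemeasurable
    exact (h1.div (by fun_prop)).aestronglyMeasurable
  have hpos (p : R3 × R3) : 0 ≤ g p.1 * f p.2 / ‖p.1 - p.2‖ :=
    div_nonneg (mul_nonneg (hg0 _) (hf0 _)) (norm_nonneg _)
  have hint (x : R3) : ∫ y, g x * f y / ‖x - y‖ = g x * ∫ y, f y / ‖x - y‖ := by
    simp only [mul_div_assoc]
    rw [integral_const_mul]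
  have hle (x : R3) : g x * ∫ y, f y / ‖x - y‖ ≤ V * g x := by
    rw [mul_comm]
    exact mul_le_mul_of_nonneg_right (hf x).2 (hg0 x)
  have hle0 (x : R3) : 0 ≤ g x * ∫ y, f y / ‖x - y‖ :=
    mul_nonneg (hg0 x) (integral_nonneg fun y => div_nonneg (hf0 y) (norm_nonneg _))
  have hI : Integrable (fun p : R3 × R3 => g p.1 * f p.2 / ‖p.1 - p.2‖)
      (volume.prod volume) := by
    refine (integrable_prod_iff hm).2 ⟨Eventually.of_forall fun x => ?_, ?_⟩
    · simp only [mul_div_assoc]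
      exact (hf x).1.const_mul _
    · refine (hg.const_mul V).mono' hm.norm.integral_prod_right' (Eventually.of_forall fun x => ?_)
      have hn (y : R3) : ‖g x * f y / ‖x - y‖‖ = g x * f y / ‖x - y‖ :=
        Real.norm_of_nonneg (hpos (x, y))
      simp only [hn]
      rw [hint, Real.norm_of_nonneg (hle0 x)]
      exact hle x
  refine ⟨hI, ?_⟩
  rw [Measure.volume_eq_prod, integral_prod _ hI, ← integral_const_mul]
  have hII := hI.integral_prod_left
  simp only [hint] at hII ⊢
  exact integral_mono hII (hg.const_mul V) hle

theorem integrable_coulomb_prod_symm {f g : R3 → ℝ} {V : ℝ} (hg : Integrable g volume)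
    (hg0 : 0 ≤ g) (hf : HasPotentialBound f V) (hfm : AEStronglyMeasurable f volume)
    (hf0 : 0 ≤ f) :
    Integrable (fun p : R3 × R3 => f p.1 * g p.2 / ‖p.1 - p.2‖) volume ∧
      ∫ p : R3 × R3, f p.1 * g p.2 / ‖p.1 - p.2‖ ≤ V * ∫ x, g x := by
  obtain ⟨h1, h2⟩ := integrable_coulomb_prod hg hg0 hf hfm hf0
  have he : (fun p : R3 × R3 => f p.1 * g p.2 / ‖p.1 - p.2‖) =
      (fun p : R3 × R3 => g p.1 * f p.2 / ‖p.1 - p.2‖) ∘ Prod.swap := by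
    ext p
    simp [mul_comm, norm_sub_rev]
  rw [he]
  refine ⟨h1.swap, ?_⟩
  refine le_trans (le_of_eq ?_) h2
  exact integral_prod_swap (μ := (volume : Measure R3)) (ν := (volume : Measure R3))
    (fun p : R3 × R3 => g p.1 * f p.2 / ‖p.1 - p.2‖)

theorem integrable_coulomb {u : R3 → 𝕜} (hu : u ∈ H1 𝕜) :
    Integrable (fun p : R3 × R3 => ‖u p.1‖ ^ 2 * ‖u p.2‖ ^ 2 / ‖p.1 - p.2‖) volume :=
  (integrable_coulomb_prod (integrable_norm_sq hu.1) (fun _ => by positivity)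
    (hasPotentialBound_norm_sq hu) (integrable_norm_sq hu.1).1 (fun _ => by positivity)).1

theorem integrable_norm_mul_norm {a b : R3 → 𝕜} (ha : MemLp a 2 volume) (hb : MemLp b 2 volume) :
    Integrable (fun x => ‖a x‖ * ‖b x‖) volume := by
  refine ((integrable_norm_sq ha).add (integrable_norm_sq hb)).mono' (ha.1.norm.mul hb.1.norm)
    (Eventually.of_forall fun x => ?_)
  rw [Real.norm_of_nonneg (by positivity), Pi.add_apply]
  nlinarith [sq_nonneg (‖a x‖ - ‖b x‖), sq_nonneg (‖a x‖), sq_nonneg (‖b x‖)]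

/-- The Coulomb energy splits up to an interaction term. -/
theorem coulomb_add_le {a b : R3 → 𝕜} (ha : a ∈ H1 𝕜) (hb : b ∈ H1 𝕜)
    (hab : (fun x => a x + b x) ∈ H1 𝕜) {V : ℝ}
    (hV : HasPotentialBound (fun x => ‖a x‖ ^ 2 + ‖b x‖ ^ 2) V) :
    coulomb a + coulomb b ≤ coulomb (fun x => a x + b x) + 4 * V * ∫ x, ‖a x‖ * ‖b x‖ := by
  have hH : Integrable (fun x => 2 * (‖a x‖ * ‖b x‖)) volume :=
    (integrable_norm_mul_norm ha.1 hb.1).const_mul 2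
  have hF := ((integrable_norm_sq ha.1).add (integrable_norm_sq hb.1)).1
  obtain ⟨i1, l1⟩ := integrable_coulomb_prod hH (fun _ => by positivity) hV hF
    (fun _ => by positivity)
  obtain ⟨i2, l2⟩ := integrable_coulomb_prod_symm hH (fun _ => by positivity) hV hF
    (fun _ => by positivity)
  rw [integral_const_mul] at l1 l2
  have i3 := integrable_coulomb hab
  have i4 := integrable_coulomb ha
  have i5 := integrable_coulomb hb
  have key := integral_mono (i4.add i5) ((i3.add i1).add i2) (fun p => by
    simp only [Pi.add_apply, ← add_div]
    refine div_le_div_of_nonneg_right ?_ (norm_nonneg _)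
    -- Write `F = A² + B²` and `H = 2AB`. Then `‖a + b‖² ≥ (A - B)² = F - H` at both points, and the
    -- product is at least `A²A'² + B²B'² - HF' - FH'`. Each of the last two terms contributes at
    -- most `2V ∫ ‖a‖‖b‖`.
    have h1 := abs_norm_sub_norm_le (a p.1) (-b p.1)
    have h2 := abs_norm_sub_norm_le (a p.2) (-b p.2)
    simp only [norm_neg, sub_neg_eq_add] at h1 h2
    have h1' := sq_le_sq'
      (by linarith [abs_nonneg (‖a p.1‖ - ‖b p.1‖), norm_nonneg (a p.1 + b p.1)]) h1
    have h2' := sq_le_sq'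
      (by linarith [abs_nonneg (‖a p.2‖ - ‖b p.2‖), norm_nonneg (a p.2 + b p.2)]) h2
    rw [sq_abs] at h1' h2'
    have h3 := mul_le_mul h1' h2' (by positivity) (by positivity)
    have ha1 := norm_nonneg (a p.1)
    have hb1 := norm_nonneg (b p.1)
    have ha2 := norm_nonneg (a p.2)
    have hb2 := norm_nonneg (b p.2)
    set A := ‖a p.1‖
    set B := ‖b p.1‖
    set A' := ‖a p.2‖
    set B' := ‖b p.2‖
    have h4 : 0 ≤ 4 * (A * B) * (A' * B') + A ^ 2 * B' ^ 2 + B ^ 2 * A' ^ 2 := by positivity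
    nlinarith)
  have e1 := integral_add i4 i5
  have e2 := integral_add (i3.add i1) i2
  have e3 := integral_add i3 i1
  simp only [Pi.add_apply] at key e1 e2 e3
  simp only [coulomb]
  linarith

theorem integrable_norm_sq_mul_norm {a b : R3 → 𝕜} (ha : a ∈ H1 𝕜) (hb : b ∈ H1 𝕜) :
    Integrable (fun x => ‖a x‖ ^ 2 * ‖b x‖) volume := by
  refine ((integrable_norm_pow_four ha).add (integrable_norm_sq hb.1)).mono'
    ((ha.1.1.norm.pow 2).mul hb.1.1.norm) (Eventually.of_forall fun x => ?_)
  rw [Real.norm_of_nonneg (by positivity), Pi.add_apply]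
  nlinarith [sq_nonneg (‖a x‖ ^ 2 - ‖b x‖), sq_nonneg (‖a x‖ ^ 2), sq_nonneg (‖b x‖)]

theorem powerInt_half_add_le {a b : R3 → 𝕜} (ha : a ∈ H1 𝕜) (hb : b ∈ H1 𝕜)
    (hab : (fun x => a x + b x) ∈ H1 𝕜) :
    powerInt (1 / 2) (fun x => a x + b x) ≤ powerInt (1 / 2) a + powerInt (1 / 2) b +
      3 * ((∫ x, ‖a x‖ ^ 2 * ‖b x‖) + ∫ x, ‖b x‖ ^ 2 * ‖a x‖) := by
  simp only [powerInt_half]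
  have i1 := integrable_norm_pow_three ha
  have i2 := integrable_norm_pow_three hb
  have i3 := (integrable_norm_sq_mul_norm ha hb).const_mul 3
  have i4 := (integrable_norm_sq_mul_norm hb ha).const_mul 3
  have key := integral_mono (integrable_norm_pow_three hab) ((i1.add i2).add (i3.add i4))
    (fun x => by
      simp only [Pi.add_apply]
      calc ‖a x + b x‖ ^ 3 ≤ (‖a x‖ + ‖b x‖) ^ 3 := by gcongr; exact norm_add_le _ _
        _ = _ := by ring)
  have e1 := integral_add (i1.add i2) (i3.add i4)
  have e2 := integral_add i1 i2
  have e3 := integral_add i3 i4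
  simp only [Pi.add_apply] at e1 e2 e3 key
  rw [integral_const_mul, integral_const_mul] at e3
  linarith

/-! ### Scaling and translation laws. -/

/-- The rescaled and translated function `x ↦ μ u(lx + y)`. -/
def rescale (μ l : ℝ) (y : R3) (u : R3 → 𝕜) : R3 → 𝕜 := fun x => μ • u (l • x + y)

/-- The general space serves both `R3` and `R3 × R3`, where the Coulomb integral lives. -/
theorem integral_comp_affine {E F : Type*} [NormedAddCommGroup E] [NormedSpace ℝ E]
    [MeasurableSpace E] [BorelSpace E] [FiniteDimensional ℝ E] (ν : Measure E)
    [ν.IsAddHaarMeasure] [NormedAddCommGroup F] [NormedSpace ℝ F] (f : E → F) {l : ℝ}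
    (hl : 0 < l) (y : E) :
    ∫ x, f (l • x + y) ∂ν = (l ^ Module.finrank ℝ E)⁻¹ • ∫ x, f x ∂ν := by
  rw [Measure.integral_comp_smul_of_nonneg ν (fun x => f (x + y)) l (hR := hl.le),
    integral_add_right_eq_self]

theorem quasiMeasurePreserving_affine {l : ℝ} (hl : 0 < l) (y : R3) :
    Measure.QuasiMeasurePreserving (fun x : R3 => l • x + y) volume volume := by
  have h1 : Measure.QuasiMeasurePreserving (fun x : R3 => l • x) volume volume := by
    refine ⟨by fun_prop, ?_⟩
    rw [Measure.map_addHaar_smul volume hl.ne']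
    exact Measure.smul_absolutelyContinuous
  exact (measurePreserving_add_right volume y).quasiMeasurePreserving.comp h1

theorem memLp_two_rescale {u : R3 → 𝕜} (hu : MemLp u 2 volume) (μ : ℝ) {l : ℝ} (hl : 0 < l)
    (y : R3) : MemLp (rescale μ l y u) 2 volume := by
  have hm : AEStronglyMeasurable (fun x => u (l • x + y)) volume :=
    hu.1.comp_quasiMeasurePreserving (quasiMeasurePreserving_affine hl y)
  refine MemLp.const_smul ((memLp_two_iff_integrable_sq_norm hm).2 ?_) μ
  exact ((integrable_norm_sq hu).comp_add_right y).comp_smul hl.ne'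

/-- Test the relation for `u` against `η` pulled back by the inverse affine map; the chain rule
supplies the factor `l`. -/
theorem hasWeakPartial_rescale {u g : R3 → 𝕜} {i : Fin 3} (h : HasWeakPartial i u g) (μ : ℝ)
    {l : ℝ} (hl : 0 < l) (y : R3) :
    HasWeakPartial i (rescale μ l y u) (rescale (μ * l) l y g) := by
  intro η hη hc
  let θ : R3 → ℝ := fun ξ => η (l⁻¹ • (ξ - y))
  have hθ : ContDiff ℝ ∞ θ := hη.comp (by fun_prop)
  have hA (x : R3) : l⁻¹ • ((l • x + y) - y) = x := by
    rw [add_sub_cancel_right, smul_smul, inv_mul_cancel₀ hl.ne', one_smul]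
  have hθx (x : R3) : θ (l • x + y) = η x := by simp only [θ, hA]
  have hθc : HasCompactSupport θ := by
    have h1 : HasCompactSupport fun ξ : R3 => η (ξ - y) :=
      hc.comp_homeomorph (Homeomorph.subRight y)
    have h2 : HasCompactSupport fun ξ : R3 => η (l⁻¹ • ξ - l⁻¹ • y) :=
      (hc.comp_homeomorph (Homeomorph.subRight (l⁻¹ • y))).comp_smul (inv_ne_zero hl.ne')
    simpa only [θ, smul_sub] using h2
  have hd (x : R3) (v : R3) : fderiv ℝ θ (l • x + y) v = l⁻¹ * fderiv ℝ η x v := by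
    have h1 : HasFDerivAt θ ((fderiv ℝ η (l⁻¹ • ((l • x + y) - y))).comp
        (l⁻¹ • ContinuousLinearMap.id ℝ R3)) (l • x + y) :=
      (hη.differentiable (by simp) _).hasFDerivAt.comp (l • x + y)
        (((hasFDerivAt_id _).sub_const y).const_smul l⁻¹)
    rw [h1.fderiv, hA]
    simp
  have key := h θ hθ hθc
  have e1 := integral_comp_affine volume
    (fun x => (fderiv ℝ θ x (EuclideanSpace.single i 1)) • u x) hl y
  have e2 := integral_comp_affine volume (fun x => θ x • g x) hl y
  rw [key] at e1
  simp only [hd, hθx] at e1 e2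
  have e3 : ∀ x, (fderiv ℝ η x (EuclideanSpace.single i 1)) • rescale μ l y u x =
      (μ * l) • ((l⁻¹ * fderiv ℝ η x (EuclideanSpace.single i 1)) • u (l • x + y)) := by
    intro x
    simp only [rescale, smul_smul]
    congr 1
    field_simp
  have e4 : ∀ x, η x • rescale (μ * l) l y g x = (μ * l) • (η x • g (l • x + y)) := by
    intro x
    simp only [rescale, smul_smul]
    congr 1
    ring
  simp only [e3, e4]
  rw [integral_smul, integral_smul, e1, e2, smul_neg, smul_neg]

theorem weakPartial_rescale {u : R3 → 𝕜} {i : Fin 3} (h : HasL2Partial i u) (μ : ℝ)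
    {l : ℝ} (hl : 0 < l) (y : R3) :
    weakPartial i (rescale μ l y u) =ᵐ[volume] rescale (μ * l) l y (weakPartial i u) :=
  weakPartial_ae_unique (memLp_two_rescale (weakPartial_spec h).1 _ hl y)
    (hasWeakPartial_rescale (weakPartial_spec h).2 μ hl y)

theorem rescale_mem_H1 {u : R3 → 𝕜} (hu : u ∈ H1 𝕜) (μ : ℝ) {l : ℝ} (hl : 0 < l) (y : R3) :
    rescale μ l y u ∈ H1 𝕜 :=
  ⟨memLp_two_rescale hu.1 μ hl y, fun i => ⟨_,
    memLp_two_rescale (weakPartial_spec (hu.2 i)).1 _ hl y,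
    hasWeakPartial_rescale (weakPartial_spec (hu.2 i)).2 μ hl y⟩⟩

theorem mass_rescale (u : R3 → 𝕜) (μ : ℝ) {l : ℝ} (hl : 0 < l) (y : R3) :
    mass (rescale μ l y u) = μ ^ 2 / l ^ 3 * mass u := by
  have := integral_comp_affine volume (fun x => ‖u x‖ ^ 2) hl y
  simp only [mass, rescale, norm_smul, mul_pow, Real.norm_eq_abs, sq_abs]
  rw [integral_const_mul, this]
  simp
  ring

theorem gradSq_rescale {u : R3 → 𝕜} (hu : u ∈ H1 𝕜) (μ : ℝ) {l : ℝ} (hl : 0 < l) (y : R3) :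
    gradSq (rescale μ l y u) = μ ^ 2 / l * gradSq u := by
  rw [gradSq_eq_sum (rescale_mem_H1 hu μ hl y), gradSq_eq_sum hu, Finset.mul_sum]
  refine Finset.sum_congr rfl fun i _ => ?_
  have h1 : ∫ x, ‖weakPartial i (rescale μ l y u) x‖ ^ 2 =
      mass (rescale (μ * l) l y (weakPartial i u)) := by
    refine integral_congr_ae ?_
    filter_upwards [weakPartial_rescale (hu.2 i) μ hl y] with x hx
    rw [hx]
  rw [h1, mass_rescale _ _ hl, mass]
  field_simp

theorem coulomb_rescale (u : R3 → 𝕜) (μ : ℝ) {l : ℝ} (hl : 0 < l) (y : R3) :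
    coulomb (rescale μ l y u) = μ ^ 4 / l ^ 5 * coulomb u := by
  have : (volume : Measure (R3 × R3)).IsAddHaarMeasure := by
    rw [Measure.volume_eq_prod]
    exact Measure.prod.instIsAddHaarMeasure _ _
  have := integral_comp_affine (volume : Measure (R3 × R3))
    (fun p : R3 × R3 => ‖u p.1‖ ^ 2 * ‖u p.2‖ ^ 2 / ‖p.1 - p.2‖) hl (y, y)
  have hfin : Module.finrank ℝ (R3 × R3) = 6 := by simp
  rw [hfin] at this
  -- Homogeneity of the kernel gives one factor `l`, against `l ^ 6` from the change of variables in
  -- dimension six.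
  have e (p : R3 × R3) : ‖rescale μ l y u p.1‖ ^ 2 * ‖rescale μ l y u p.2‖ ^ 2 / ‖p.1 - p.2‖ =
      μ ^ 4 * l * (‖u (l • p + (y, y)).1‖ ^ 2 * ‖u (l • p + (y, y)).2‖ ^ 2 /
        ‖(l • p + (y, y)).1 - (l • p + (y, y)).2‖) := by
    simp only [rescale, norm_smul, mul_pow, Real.norm_eq_abs, sq_abs, Prod.fst_add, Prod.snd_add,
      Prod.smul_fst, Prod.smul_snd, add_sub_add_right_eq_sub, ← smul_sub, abs_of_pos hl]
    -- On the diagonal both quotients are divisions by zero, hence `0`.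
    rcases eq_or_ne ‖p.1 - p.2‖ 0 with h | h
    · simp [h]
    · field_simp
  simp only [coulomb, e]
  rw [integral_const_mul, this, smul_eq_mul]
  field_simp

theorem powerInt_half_rescale (u : R3 → 𝕜) {μ : ℝ} (hμ : 0 ≤ μ) {l : ℝ} (hl : 0 < l) (y : R3) :
    powerInt (1 / 2) (rescale μ l y u) = μ ^ 3 / l ^ 3 * powerInt (1 / 2) u := by
  have := integral_comp_affine volume (fun x => ‖u x‖ ^ 3) hl y
  simp only [powerInt_half, rescale, norm_smul, mul_pow, Real.norm_of_nonneg hμ]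
  rw [integral_const_mul, this]
  simp
  ring

/-! ### The energy at the critical constant. -/

theorem energy_half (C : ℝ) (u : R3 → 𝕜) :
    energy (1 / 2) C u = 1 / 2 * gradSq u + 1 / 4 * coulomb u - C / 3 * powerInt (1 / 2) u := by
  rw [energy, show (2 * (1 / 2) + 2 : ℝ) = 3 by norm_num]

theorem bestConst_nonneg (𝕜 : Type*) [RCLike 𝕜] (α : ℝ) : 0 ≤ bestConst 𝕜 α :=
  Real.sInf_nonneg fun _ hK => hK.1.le

/-- The infimum of the admissible constants is itself admissible. The hypothesis `h` excludes an
empty set of constants, for which `sInf` returns `0`. -/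
theorem powerInt_half_le_bestConst (h : bestConst 𝕜 (1 / 2) ≠ 0) {u : R3 → 𝕜} (hu : u ∈ H1 𝕜) :
    powerInt (1 / 2) u ≤ bestConst 𝕜 (1 / 2) * (√(coulomb u) * √(gradSq u)) := by
  set S : Set ℝ := {K : ℝ | 0 < K ∧ ∀ u ∈ H1 𝕜, powerInt (1 / 2) u ≤
    K * mass u ^ (4 * (1 / 2 : ℝ) - 2) * coulomb u ^ (2 - 3 * (1 / 2 : ℝ)) *
      gradSq u ^ (3 * (1 / 2 : ℝ) - 1)} with hS
  have hb : bestConst 𝕜 (1 / 2) = sInf S := rfl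
  rw [hb] at h ⊢
  have hK : ∀ K ∈ S, powerInt (1 / 2) u ≤ K * (√(coulomb u) * √(gradSq u)) := by
    intro K hK
    have := hK.2 u hu
    -- At `α = 1/2` the mass has exponent `0` and the other two factors are square roots.
    rw [show (4 * (1 / 2) - 2 : ℝ) = 0 by norm_num, show (2 - 3 * (1 / 2) : ℝ) = 1 / 2 by norm_num,
      show (3 * (1 / 2) - 1 : ℝ) = 1 / 2 by norm_num, Real.rpow_zero, ← Real.sqrt_eq_rpow,
      ← Real.sqrt_eq_rpow, mul_one, mul_assoc] at this
    exact this
  have hne : S.Nonempty := by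
    by_contra h0
    rw [Set.not_nonempty_iff_eq_empty] at h0
    exact h (by rw [h0, Real.sInf_empty])
  have hX : 0 ≤ √(coulomb u) * √(gradSq u) := by positivity
  rcases hX.eq_or_lt with h0 | hpos
  · obtain ⟨K, hKS⟩ := hne
    have := hK K hKS
    rw [← h0, mul_zero] at this ⊢
    exact this
  · rw [← div_le_iff₀ hpos]
    exact le_csInf hne fun K hKS => (div_le_iff₀ hpos).2 (hK K hKS)

/-- At the critical coupling constant the energy is nonnegative. -/
theorem energy_half_nonneg {C : ℝ} (hC : C = 3 / (√2 * bestConst 𝕜 (1 / 2))) {u : R3 → 𝕜}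
    (hu : u ∈ H1 𝕜) : 0 ≤ energy (1 / 2) C u := by
  rw [energy_half]
  have hG := gradSq_nonneg u
  have hD := coulomb_nonneg u
  -- If the constant is `0`, division by zero gives `C = 0`, and only nonnegative terms remain.
  by_cases h : bestConst 𝕜 (1 / 2) = 0
  · rw [hC, h]
    simp only [mul_zero, div_zero, zero_div, zero_mul, sub_zero]
    positivity
  · have hpos : 0 < bestConst 𝕜 (1 / 2) := (bestConst_nonneg 𝕜 _).lt_of_ne' h
    have hP := powerInt_half_le_bestConst h hu
    set b := bestConst 𝕜 (1 / 2)
    have h2 : (√2) ^ 2 = 2 := Real.sq_sqrt (by norm_num)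
    have h2p : 0 < √2 := by positivity
    have h3 : C / 3 * powerInt (1 / 2) u ≤ (√2)⁻¹ * (√(coulomb u) * √(gradSq u)) := by
      calc C / 3 * powerInt (1 / 2) u ≤ C / 3 * (b * (√(coulomb u) * √(gradSq u))) := by
            gcongr; rw [hC]; positivity
        _ = _ := by rw [hC]; field_simp
    -- The value of `C` is the one that turns the lower bound into a perfect square.
    have h4 : 1 / 2 * gradSq u + 1 / 4 * coulomb u - (√2)⁻¹ * (√(coulomb u) * √(gradSq u)) =
        ((√2)⁻¹ * √(gradSq u) - 1 / 2 * √(coulomb u)) ^ 2 := by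
      have e1 := Real.sq_sqrt hG
      have e2 := Real.sq_sqrt hD
      have e3 : ((√2)⁻¹) ^ 2 = 1 / 2 := by rw [inv_pow, h2]; norm_num
      calc _ = 1 / 2 * √(gradSq u) ^ 2 + 1 / 4 * √(coulomb u) ^ 2 -
            (√2)⁻¹ * (√(coulomb u) * √(gradSq u)) := by rw [e1, e2]
        _ = _ := by linear_combination (-√(gradSq u) ^ 2) * e3
    have := sq_nonneg ((√2)⁻¹ * √(gradSq u) - 1 / 2 * √(coulomb u))
    linarith

/-- This is the scaling under which all three terms are multiplied by the same power of `l`, so zero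
energy is preserved while the mass can be adjusted. -/
theorem energy_half_rescale_sq {u : R3 → 𝕜} (hu : u ∈ H1 𝕜) (C : ℝ) {l : ℝ} (hl : 0 < l) :
    energy (1 / 2) C (rescale (l ^ 2) l 0 u) = l ^ 3 * energy (1 / 2) C u := by
  rw [energy_half, energy_half, gradSq_rescale hu _ hl, coulomb_rescale _ _ hl,
    powerInt_half_rescale _ (by positivity) hl]
  field_simp

theorem energy_half_translate {u : R3 → 𝕜} (hu : u ∈ H1 𝕜) (C : ℝ) (y : R3) :
    energy (1 / 2) C (rescale 1 1 y u) = energy (1 / 2) C u := by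
  rw [energy_half, energy_half, gradSq_rescale hu _ one_pos, coulomb_rescale _ _ one_pos,
    powerInt_half_rescale _ zero_le_one one_pos]
  simp

/-- The function `u` only witnesses that the constraint set is nonempty. Its dilations `s³ u(s² x)`
keep the mass and have energy tending to `0` with `s`; the lower bound is `energy_half_nonneg`. -/
theorem infEnergy_half_eq_zero {C : ℝ} (hC : C = 3 / (√2 * bestConst 𝕜 (1 / 2)))
    {u : R3 → 𝕜} (hu : u ∈ massSet 𝕜 1) : infEnergy 𝕜 (1 / 2) C 1 = 0 := by
  refine le_antisymm ?_ ?_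
  · let e : ℝ → ℝ := fun s => 1 / 2 * (s ^ 4 * gradSq u) + 1 / 4 * (s ^ 2 * coulomb u) -
      C / 3 * (s ^ 3 * powerInt (1 / 2) u)
    have he : Tendsto e (𝓝[>] 0) (𝓝 0) := by
      have : Continuous e := by fun_prop
      have h := this.tendsto 0
      simp only [e] at h
      norm_num at h
      exact h.mono_left nhdsWithin_le_nhds
    have he' : Tendsto (fun s => (e s : EReal)) (𝓝[>] 0) (𝓝 0) :=
      (continuous_coe_real_ereal.tendsto 0).comp he
    refine ge_of_tendsto he' ?_
    filter_upwards [self_mem_nhdsWithin] with s hs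
    have hs : 0 < s := hs
    have hl : 0 < s ^ 2 := by positivity
    have hmem : rescale (s ^ 3) (s ^ 2) 0 u ∈ massSet 𝕜 1 := by
      refine ⟨rescale_mem_H1 hu.1 _ hl 0, ?_⟩
      rw [mass_rescale _ _ hl, hu.2]
      field_simp
    have hE : energy (1 / 2) C (rescale (s ^ 3) (s ^ 2) 0 u) = e s := by
      rw [energy_half, gradSq_rescale hu.1 _ hl, coulomb_rescale _ _ hl,
        powerInt_half_rescale _ (by positivity) hl]
      simp only [e]
      field_simp
    rw [← hE]
    exact iInf₂_le _ hmem
  · refine le_iInf₂ fun v hv => ?_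
    exact EReal.coe_nonneg.2 (energy_half_nonneg hC hv.1)

/-- A nonzero function of zero energy can be rescaled to a minimizer. -/
theorem exists_isMinimizer_of_energy_eq_zero {C : ℝ}
    (hC : C = 3 / (√2 * bestConst 𝕜 (1 / 2))) {u : R3 → 𝕜} (hu : u ∈ H1 𝕜) (hm : 0 < mass u)
    (hE : energy (1 / 2) C u = 0) : ∃ ψ : R3 → 𝕜, IsMinimizer (1 / 2) C 1 ψ := by
  -- Under `l² u(l x)` the mass is multiplied by `l`, so `l = 1 / mass u` normalizes it.
  have hl : 0 < (mass u)⁻¹ := by positivity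
  have hmem : rescale ((mass u)⁻¹ ^ 2) (mass u)⁻¹ 0 u ∈ massSet 𝕜 1 := by
    refine ⟨rescale_mem_H1 hu _ hl 0, ?_⟩
    rw [mass_rescale _ _ hl]
    field_simp
  refine ⟨_, hmem, ?_⟩
  rw [infEnergy_half_eq_zero hC hmem, energy_half_rescale_sq hu C hl, hE]
  simp

/-! ### Weak convergence in `L²` and `H¹`. -/

/-- Weak convergence in `L²(ℝ³)`. -/
def WeakL2Tendsto (u : ℕ → R3 → 𝕜) (v : R3 → 𝕜) : Prop :=
  ∀ g : R3 → 𝕜, MemLp g 2 volume →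
    Tendsto (fun n => ∫ x, inner 𝕜 (g x) (u n x)) atTop (𝓝 (∫ x, inner 𝕜 (g x) (v x)))

theorem WeakL2Tendsto.comp {u : ℕ → R3 → 𝕜} {v : R3 → 𝕜} (h : WeakL2Tendsto u v) {σ : ℕ → ℕ}
    (hσ : StrictMono σ) : WeakL2Tendsto (fun n => u (σ n)) v :=
  fun g hg => (h g hg).comp hσ.tendsto_atTop

theorem integrable_inner_of_memLp {f g : R3 → 𝕜} (hf : MemLp f 2 volume) (hg : MemLp g 2 volume) :
    Integrable (fun x => inner 𝕜 (f x) (g x)) volume := by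
  refine (L2.integrable_inner (𝕜 := 𝕜) (hf.toLp f) (hg.toLp g)).congr ?_
  filter_upwards [hf.coeFn_toLp, hg.coeFn_toLp] with x h1 h2
  rw [h1, h2]

theorem inner_toLp {f g : R3 → 𝕜} (hf : MemLp f 2 volume) (hg : MemLp g 2 volume) :
    inner 𝕜 (hf.toLp f) (hg.toLp g) = ∫ x, inner 𝕜 (f x) (g x) := by
  rw [L2.inner_def]
  refine integral_congr_ae ?_
  filter_upwards [hf.coeFn_toLp, hg.coeFn_toLp] with x h1 h2
  rw [h1, h2]

/-- The Riesz isometry carries the sequence into a ball of the dual, where sequential Banach-Alaoglu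
applies. -/
theorem exists_weakL2Tendsto {u : ℕ → R3 → 𝕜} (hu : ∀ n, MemLp (u n) 2 volume) {B : ℝ}
    (hB : ∀ n, ∫ x, ‖u n x‖ ^ 2 ≤ B) :
    ∃ v : R3 → 𝕜, MemLp v 2 volume ∧ ∃ σ : ℕ → ℕ, StrictMono σ ∧
      WeakL2Tendsto (fun n => u (σ n)) v := by
  have : Fact ((2 : ℝ≥0∞) ≠ ⊤) := ⟨by norm_num⟩
  let E := Lp 𝕜 2 (volume : Measure R3)
  let T : ℕ → WeakDual 𝕜 E := fun n =>
    StrongDual.toWeakDual (InnerProductSpace.toDual 𝕜 E ((hu n).toLp (u n)))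
  have hT n : T n ∈ (WeakDual.toStrongDual ⁻¹' Metric.closedBall (0 : StrongDual 𝕜 E) √B) := by
    simp only [T, Set.mem_preimage, mem_closedBall_zero_iff]
    change ‖InnerProductSpace.toDual 𝕜 E ((hu n).toLp (u n))‖ ≤ √B
    rw [LinearIsometryEquiv.norm_map, Lp.norm_toLp]
    refine Real.le_sqrt_of_sq_le ?_
    have h := toReal_eLpNorm_pow (n := 2) two_ne_zero (hu n)
    push_cast at h
    exact h.trans_le (hB n)
  obtain ⟨ψ, -, σ, hσ, hψ⟩ := WeakDual.isSeqCompact_closedBall 𝕜 E 0 √B hT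
  let w : E := (InnerProductSpace.toDual 𝕜 E).symm (WeakDual.toStrongDual ψ)
  refine ⟨w, Lp.memLp w, σ, hσ, fun g hg => ?_⟩
  have h1 : Tendsto (fun n => T (σ n) (hg.toLp g)) atTop (𝓝 (ψ (hg.toLp g))) :=
    ((WeakDual.eval_continuous (hg.toLp g)).tendsto ψ).comp hψ
  have h2 n : T (σ n) (hg.toLp g) = inner 𝕜 ((hu (σ n)).toLp (u (σ n))) (hg.toLp g) := rfl
  have h3 : ψ (hg.toLp g) = inner 𝕜 w (hg.toLp g) := by
    simp only [w, InnerProductSpace.toDual_symm_apply]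
    rfl
  simp only [h2, h3] at h1
  -- `toDual` puts the sequence in the first slot of the inner product; conjugation moves it to the
  -- second.
  have h4 := (RCLike.continuous_conj.tendsto _).comp h1
  simp only [Function.comp_def, inner_conj_symm] at h4
  have h5 : starRingEnd 𝕜 (inner 𝕜 w (hg.toLp g)) = ∫ x, inner 𝕜 (g x) (w x) := by
    rw [← inner_toLp hg (Lp.memLp w), Lp.toLp_coeFn]
    exact inner_conj_symm _ _
  rw [h5] at h4
  simpa only [inner_toLp] using h4

theorem inner_ofReal_left (r : ℝ) (z : 𝕜) : inner 𝕜 (r : 𝕜) z = r • z := by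
  rw [RCLike.inner_apply, RCLike.conj_ofReal, mul_comm, RCLike.real_smul_eq_coe_mul]

theorem WeakL2Tendsto.tendsto_integral_smul {u : ℕ → R3 → 𝕜} {v : R3 → 𝕜}
    (h : WeakL2Tendsto u v) {η : R3 → ℝ} (hη : Continuous η) (hc : HasCompactSupport η) :
    Tendsto (fun n => ∫ x, η x • u n x) atTop (𝓝 (∫ x, η x • v x)) := by
  have hm : MemLp (fun x => (η x : 𝕜)) 2 volume := by
    refine Continuous.memLp_of_hasCompactSupport (by fun_prop) ?_
    exact hc.comp_left (g := fun r : ℝ => (r : 𝕜)) (by simp)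
  simpa only [inner_ofReal_left] using h _ hm

theorem HasWeakPartial.of_weakL2Tendsto {u g : ℕ → R3 → 𝕜} {v w : R3 → 𝕜} {i : Fin 3}
    (h : ∀ n, HasWeakPartial i (u n) (g n)) (hu : WeakL2Tendsto u v) (hg : WeakL2Tendsto g w) :
    HasWeakPartial i v w := by
  intro η hη hc
  have h1 := hu.tendsto_integral_smul
    (η := fun x => fderiv ℝ η x (EuclideanSpace.single i 1))
    ((hη.continuous_fderiv (by simp)).clm_apply continuous_const) (hc.fderiv_apply ℝ _)
  have h2 := (hg.tendsto_integral_smul hη.continuous hc).neg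
  simp only [fun n => h n η hη hc] at h1
  exact tendsto_nhds_unique h1 h2

/-- A bounded sequence in `H¹` has a weakly convergent subsequence. -/
theorem exists_weak_subseq_H1 {u : ℕ → R3 → 𝕜} (hu : ∀ n, u n ∈ H1 𝕜) {A B : ℝ}
    (hA : ∀ n, mass (u n) ≤ A) (hB : ∀ n, gradSq (u n) ≤ B) :
    ∃ v ∈ H1 𝕜, ∃ σ : ℕ → ℕ, StrictMono σ ∧ WeakL2Tendsto (fun n => u (σ n)) v ∧
      ∀ i, WeakL2Tendsto (fun n => weakPartial i (u (σ n))) (weakPartial i v) := by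
  have hm i n : MemLp (weakPartial i (u n)) 2 volume := (weakPartial_spec ((hu n).2 i)).1
  have hb i n : ∫ x, ‖weakPartial i (u n) x‖ ^ 2 ≤ B := by
    refine le_trans ?_ (hB n)
    rw [gradSq_eq_sum (hu n)]
    exact Finset.single_le_sum (f := fun i => ∫ x, ‖weakPartial i (u n) x‖ ^ 2)
      (fun i _ => integral_nonneg fun x => by positivity) (Finset.mem_univ i)
  obtain ⟨v, hv, σ, hσ, hvσ⟩ := exists_weakL2Tendsto (fun n => (hu n).1) hA
  obtain ⟨w0, hw0, τ0, hτ0, h0⟩ := exists_weakL2Tendsto (fun n => hm 0 (σ n)) (fun n => hb 0 _)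
  obtain ⟨w1, hw1, τ1, hτ1, h1⟩ := exists_weakL2Tendsto (fun n => hm 1 (σ (τ0 n)))
    (fun n => hb 1 _)
  obtain ⟨w2, hw2, τ2, hτ2, h2⟩ := exists_weakL2Tendsto (fun n => hm 2 (σ (τ0 (τ1 n))))
    (fun n => hb 2 _)
  have hall : ∀ i : Fin 3, ∃ w, MemLp w 2 volume ∧
      WeakL2Tendsto (fun n => weakPartial i (u (σ (τ0 (τ1 (τ2 n)))))) w := by
    intro i
    fin_cases i
    · exact ⟨w0, hw0, (h0.comp hτ1).comp hτ2⟩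
    · exact ⟨w1, hw1, h1.comp hτ2⟩
    · exact ⟨w2, hw2, h2⟩
  have hvτ : WeakL2Tendsto (fun n => u (σ (τ0 (τ1 (τ2 n))))) v :=
    ((hvσ.comp hτ0).comp hτ1).comp hτ2
  choose w hw hwt using hall
  have hp i : HasWeakPartial i v (w i) :=
    HasWeakPartial.of_weakL2Tendsto (fun n => (weakPartial_spec ((hu _).2 i)).2) hvτ (hwt i)
  refine ⟨v, ⟨hv, fun i => ⟨w i, hw i, hp i⟩⟩, fun n => σ (τ0 (τ1 (τ2 n))),
    hσ.comp (hτ0.comp (hτ1.comp hτ2)), hvτ, fun i g hg => ?_⟩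
  have he := weakPartial_ae_unique (hw i) (hp i)
  have : ∫ x, inner 𝕜 (g x) (weakPartial i v x) = ∫ x, inner 𝕜 (g x) (w i x) := by
    refine integral_congr_ae ?_
    filter_upwards [he] with x hx
    rw [hx]
  rw [this]
  exact hwt i g hg

theorem integral_norm_sub_sq {f g : R3 → 𝕜} (hf : MemLp f 2 volume) (hg : MemLp g 2 volume) :
    ∫ x, ‖f x - g x‖ ^ 2 = (∫ x, ‖f x‖ ^ 2) + (∫ x, ‖g x‖ ^ 2) -
      2 * RCLike.re (∫ x, inner 𝕜 (g x) (f x)) := by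
  have h1 := integrable_norm_sq hf
  have h2 := integrable_norm_sq hg
  have h3 := integrable_inner_of_memLp hg hf
  have e1 := integral_sub (h1.add h2) (h3.re.const_mul 2)
  have e2 := integral_add h1 h2
  simp only [Pi.add_apply] at e1 e2
  rw [← integral_re h3, ← integral_const_mul, ← e2, ← e1]
  congr 1 with x
  rw [norm_sub_sq (𝕜 := 𝕜), ← inner_conj_symm, RCLike.conj_re]
  ring

/-- Expanding the square leaves `2‖v‖² - 2 Re ⟨v, u_n⟩`, which is linear in `u_n`. -/
theorem WeakL2Tendsto.tendsto_integral_norm_sub_sq {u : ℕ → R3 → 𝕜} {v : R3 → 𝕜}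
    (h : WeakL2Tendsto u v) (hu : ∀ n, MemLp (u n) 2 volume) (hv : MemLp v 2 volume) :
    Tendsto (fun n => (∫ x, ‖v x‖ ^ 2) + (∫ x, ‖u n x - v x‖ ^ 2) - ∫ x, ‖u n x‖ ^ 2) atTop
      (𝓝 0) := by
  have h1 := (RCLike.continuous_re.tendsto _).comp (h v hv)
  have h2 : RCLike.re (∫ x, inner 𝕜 (v x) (v x)) = ∫ x, ‖v x‖ ^ 2 := by
    rw [← integral_re (integrable_inner_of_memLp hv hv)]
    congr 1 with x
    rw [inner_self_eq_norm_sq]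
  rw [h2] at h1
  have h3 := (h1.const_mul (-2)).add_const (2 * ∫ x, ‖v x‖ ^ 2)
  rw [show -2 * (∫ x, ‖v x‖ ^ 2) + 2 * ∫ x, ‖v x‖ ^ 2 = 0 by ring] at h3
  refine h3.congr fun n => ?_
  rw [integral_norm_sub_sq (hu n) hv]
  simp only [Function.comp]
  ring

theorem integral_norm_sub_sq_le {f g : R3 → 𝕜} (hf : MemLp f 2 volume) (hg : MemLp g 2 volume) :
    ∫ x, ‖f x - g x‖ ^ 2 ≤ 2 * (∫ x, ‖f x‖ ^ 2) + 2 * ∫ x, ‖g x‖ ^ 2 := by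
  have h1 := (integrable_norm_sq hf).const_mul 2
  have h2 := (integrable_norm_sq hg).const_mul 2
  rw [← integral_const_mul, ← integral_const_mul, ← integral_add h1 h2]
  refine integral_mono (integrable_norm_sq (hf.sub hg)) (h1.add h2) fun x => ?_
  have := norm_sub_le (f x) (g x)
  have h0 := norm_nonneg (f x - g x)
  change ‖f x - g x‖ ^ 2 ≤ 2 * ‖f x‖ ^ 2 + 2 * ‖g x‖ ^ 2
  nlinarith [sq_nonneg (‖f x‖ - ‖g x‖)]

theorem HasWeakPartial.sub {u v g h : R3 → 𝕜} {i : Fin 3} (hu : MemLp u 2 volume)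
    (hv : MemLp v 2 volume) (hg : MemLp g 2 volume) (hh : MemLp h 2 volume)
    (hug : HasWeakPartial i u g) (hvh : HasWeakPartial i v h) :
    HasWeakPartial i (fun x => u x - v x) (fun x => g x - h x) := by
  intro η hη hc
  have key (θ : R3 → ℝ) (hθ : Continuous θ) (hθc : HasCompactSupport θ) {f : R3 → 𝕜}
      (hf : MemLp f 2 volume) : Integrable (fun x => θ x • f x) volume :=
    (hf.locallyIntegrable (by norm_num)).integrable_smul_left_of_hasCompactSupport hθ hθc
  have hd : Continuous fun x => fderiv ℝ η x (EuclideanSpace.single i 1) :=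
    (hη.continuous_fderiv (by simp)).clm_apply continuous_const
  have hdc : HasCompactSupport fun x => fderiv ℝ η x (EuclideanSpace.single i 1) :=
    hc.fderiv_apply ℝ _
  simp only [smul_sub]
  rw [integral_sub (key _ hd hdc hu) (key _ hd hdc hv),
    integral_sub (key _ hη.continuous hc hg) (key _ hη.continuous hc hh), hug η hη hc,
    hvh η hη hc]
  ring

theorem sub_mem_H1 {u v : R3 → 𝕜} (hu : u ∈ H1 𝕜) (hv : v ∈ H1 𝕜) :
    (fun x => u x - v x) ∈ H1 𝕜 :=
  ⟨hu.1.sub hv.1, fun i => ⟨_, (weakPartial_spec (hu.2 i)).1.sub (weakPartial_spec (hv.2 i)).1,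
    (weakPartial_spec (hu.2 i)).2.sub hu.1 hv.1 (weakPartial_spec (hu.2 i)).1
      (weakPartial_spec (hv.2 i)).1 (weakPartial_spec (hv.2 i)).2⟩⟩

theorem gradSq_sub_eq_sum {u v : R3 → 𝕜} (hu : u ∈ H1 𝕜) (hv : v ∈ H1 𝕜) :
    gradSq (fun x => u x - v x) =
      ∑ i : Fin 3, ∫ x, ‖weakPartial i u x - weakPartial i v x‖ ^ 2 := by
  rw [gradSq_eq_sum (sub_mem_H1 hu hv)]
  refine Finset.sum_congr rfl fun i _ => integral_congr_ae ?_
  have h1 := weakPartial_spec (hu.2 i)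
  have h2 := weakPartial_spec (hv.2 i)
  filter_upwards [weakPartial_ae_unique (h1.1.sub h2.1)
    (h1.2.sub hu.1 hv.1 h1.1 h2.1 h2.2)] with x hx
  rw [hx]
  rfl

theorem gradSq_sub_le {u v : R3 → 𝕜} (hu : u ∈ H1 𝕜) (hv : v ∈ H1 𝕜) :
    gradSq (fun x => u x - v x) ≤ 2 * gradSq u + 2 * gradSq v := by
  rw [gradSq_sub_eq_sum hu hv, gradSq_eq_sum hu, gradSq_eq_sum hv, Finset.mul_sum,
    Finset.mul_sum, ← Finset.sum_add_distrib]
  exact Finset.sum_le_sum fun i _ =>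
    integral_norm_sub_sq_le (weakPartial_spec (hu.2 i)).1 (weakPartial_spec (hv.2 i)).1

theorem tendsto_gradSq_sub {u : ℕ → R3 → 𝕜} {v : R3 → 𝕜} (hu : ∀ n, u n ∈ H1 𝕜) (hv : v ∈ H1 𝕜)
    (h : ∀ i, WeakL2Tendsto (fun n => weakPartial i (u n)) (weakPartial i v)) :
    Tendsto (fun n => gradSq v + gradSq (fun x => u n x - v x) - gradSq (u n)) atTop (𝓝 0) := by
  have := tendsto_finsetSum (Finset.univ : Finset (Fin 3)) fun i _ =>
    (h i).tendsto_integral_norm_sub_sq (fun n => (weakPartial_spec ((hu n).2 i)).1)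
      (weakPartial_spec (hv.2 i)).1
  simp only [Finset.sum_const_zero] at this
  refine this.congr fun n => ?_
  rw [gradSq_sub_eq_sum (hu n) hv, gradSq_eq_sum (hu n), gradSq_eq_sum hv,
    ← Finset.sum_add_distrib, ← Finset.sum_sub_distrib]

/-! ### Rellich's theorem on balls. -/

theorem integral_norm_sub_moll_sq_le (φ : ContDiffBump (0 : R3)) {u : R3 → 𝕜} (hu : u ∈ H1 𝕜) :
    MemLp (u - moll φ u) 2 volume ∧
      ∫ x, ‖u x - moll φ u x‖ ^ 2 ≤ φ.rOut ^ 2 * (3 * gradSq u) := by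
  have hl := hu.1.locallyIntegrable (by norm_num)
  have h := eLpNorm_sub_moll_le φ hu
  have hfin i : eLpNorm (weakPartial i u) 2 volume ≠ ⊤ := (weakPartial_spec (hu.2 i)).1.2.ne
  have htop : ENNReal.ofReal φ.rOut * ∑ i : Fin 3, eLpNorm (weakPartial i u) 2 volume ≠ ⊤ :=
    ENNReal.mul_ne_top ENNReal.ofReal_ne_top (ENNReal.sum_ne_top.2 fun i _ => hfin i)
  have hm : MemLp (u - moll φ u) 2 volume :=
    ⟨hu.1.1.sub (contDiff_moll φ hl).continuous.aestronglyMeasurable, h.trans_lt htop.lt_top⟩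
  refine ⟨hm, ?_⟩
  have hR := ENNReal.toReal_mono htop h
  rw [ENNReal.toReal_mul, ENNReal.toReal_ofReal φ.rOut_pos.le,
    ENNReal.toReal_sum (fun i _ => hfin i)] at hR
  have h2 := toReal_eLpNorm_pow (n := 2) two_ne_zero hm
  have hi i := toReal_eLpNorm_pow (n := 2) two_ne_zero (weakPartial_spec (hu.2 i)).1
  push_cast at h2 hi
  simp only [Pi.sub_apply] at h2
  rw [← h2, gradSq_eq_sum hu]
  simp only [← hi, Fin.sum_univ_three] at hR ⊢
  set b := (eLpNorm (weakPartial 0 u) 2 volume).toReal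
  set c := (eLpNorm (weakPartial 1 u) 2 volume).toReal
  set d := (eLpNorm (weakPartial 2 u) 2 volume).toReal
  calc _ ≤ (φ.rOut * (b + c + d)) ^ 2 := by gcongr
    _ = φ.rOut ^ 2 * (b + c + d) ^ 2 := by ring
    _ ≤ _ := by
      gcongr
      nlinarith [sq_nonneg (b - c), sq_nonneg (b - d), sq_nonneg (c - d)]

/-- The value of a mollification at a point is the pairing with a fixed test function. -/
theorem tendsto_moll_of_weak {b : ℕ → R3 → 𝕜} (h : WeakL2Tendsto b 0) (φ : ContDiffBump (0 : R3))
    (x : R3) : Tendsto (fun n => moll φ (b n) x) atTop (𝓝 0) := by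
  have hη : Continuous fun t => φ.normed volume (x - t) :=
    φ.continuous_normed.comp (continuous_const.sub continuous_id)
  have hc : HasCompactSupport fun t => φ.normed volume (x - t) :=
    φ.hasCompactSupport_normed.comp_homeomorph (Homeomorph.subLeft x)
  have := h.tendsto_integral_smul hη hc
  simp only [Pi.zero_apply, smul_zero, integral_zero] at this
  simpa only [moll, convolution_eq_swap, ContinuousLinearMap.lsmul_apply] using this

/-- For a fixed bump this bound is uniform in `x` and over functions of bounded mass, and serves as
the dominating constant in Rellich's theorem. -/
theorem norm_moll_le (φ : ContDiffBump (0 : R3)) {u : R3 → 𝕜} (hu : MemLp u 2 volume) (x : R3) :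
    ‖moll φ u x‖ ≤ (∫ t, φ.normed volume t ^ 2) + mass u := by
  have hc : Continuous (φ.normed (volume : Measure R3)) := φ.continuous_normed
  have h1 : Integrable (fun t => φ.normed volume t ^ 2) (volume : Measure R3) := by
    refine Continuous.integrable_of_hasCompactSupport (by fun_prop) ?_
    exact φ.hasCompactSupport_normed.comp_left (g := fun r : ℝ => r ^ 2) (by simp)
  have h2 := h1.comp_sub_left x
  rw [← integral_sub_left_eq_self (fun t => φ.normed volume t ^ 2) volume x, mass,
    ← integral_add h2 (integrable_norm_sq hu)]
  simp only [moll, convolution_eq_swap, ContinuousLinearMap.lsmul_apply]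
  refine norm_integral_le_of_norm_le (h2.add (integrable_norm_sq hu))
    (Eventually.of_forall fun t => ?_)
  rw [norm_smul, Real.norm_of_nonneg (φ.nonneg_normed _)]
  nlinarith [sq_nonneg (φ.normed volume (x - t) - ‖u t‖), sq_nonneg (φ.normed volume (x - t)),
    sq_nonneg (‖u t‖)]

/-- Rellich's theorem: weak convergence in `H¹` implies strong convergence in `L²` on balls. -/
theorem tendsto_setIntegral_ball_of_weak {b : ℕ → R3 → 𝕜} (hb : ∀ n, b n ∈ H1 𝕜) {A B : ℝ}
    (hA : ∀ n, mass (b n) ≤ A) (hB : ∀ n, gradSq (b n) ≤ B) (h : WeakL2Tendsto b 0) (R : ℝ) :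
    Tendsto (fun n => ∫ x in Metric.ball 0 R, ‖b n x‖ ^ 2) atTop (𝓝 0) := by
  have hfin : volume (Metric.ball (0 : R3) R) < ⊤ := measure_ball_lt_top
  have hmoll (k : ℕ) : Tendsto
      (fun n => ∫ x in Metric.ball 0 R, ‖moll (bumpSeq k) (b n) x‖ ^ 2) atTop (𝓝 0) := by
    set M := (∫ t, (bumpSeq k).normed (volume : Measure R3) t ^ 2) + A
    have := tendsto_integral_of_dominated_convergence
      (μ := volume.restrict (Metric.ball (0 : R3) R))
      (F := fun n x => ‖moll (bumpSeq k) (b n) x‖ ^ 2) (f := fun _ => (0 : ℝ)) (fun _ => M ^ 2)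
      (fun n => ?_) ?_ (fun n => Eventually.of_forall fun x => ?_)
      (Eventually.of_forall fun x => ?_)
    · simpa using this
    · have := (contDiff_moll (bumpSeq k) ((hb n).1.locallyIntegrable (by norm_num))).continuous
      exact Continuous.aestronglyMeasurable (by fun_prop)
    · exact integrableOn_const hfin.ne
    · rw [Real.norm_of_nonneg (by positivity)]
      gcongr
      exact (norm_moll_le _ (hb n).1 x).trans (by linarith [hA n])
    · simpa using ((tendsto_moll_of_weak h (bumpSeq k) x).norm.pow 2)
  -- The error of mollification is small uniformly in `n`, so `k` can be fixed before `n` tends to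
  -- infinity.
  have hbound (k n : ℕ) : ∫ x in Metric.ball 0 R, ‖b n x‖ ^ 2 ≤
      2 * (∫ x in Metric.ball 0 R, ‖moll (bumpSeq k) (b n) x‖ ^ 2) +
        2 * ((bumpSeq k).rOut ^ 2 * (3 * B)) := by
    obtain ⟨hm, hle⟩ := integral_norm_sub_moll_sq_le (bumpSeq k) (hb n)
    have i0 := (integrable_norm_sq (hb n).1).integrableOn (s := Metric.ball (0 : R3) R)
    have i1 : IntegrableOn (fun x => ‖moll (bumpSeq k) (b n) x‖ ^ 2) (Metric.ball 0 R) volume := by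
      have := (contDiff_moll (bumpSeq k) ((hb n).1.locallyIntegrable (by norm_num))).continuous
      have hc : Continuous fun x => ‖moll (bumpSeq k) (b n) x‖ ^ 2 := by fun_prop
      exact (hc.continuousOn.integrableOn_compact (isCompact_closedBall 0 R)).mono_set
        Metric.ball_subset_closedBall
    have i2 := integrable_norm_sq hm
    have h1 : ∫ x in Metric.ball 0 R, ‖b n x‖ ^ 2 ≤ ∫ x in Metric.ball 0 R,
        (2 * ‖moll (bumpSeq k) (b n) x‖ ^ 2 + 2 * ‖(b n - moll (bumpSeq k) (b n)) x‖ ^ 2) := by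
      refine integral_mono i0 ((i1.const_mul 2).add (i2.integrableOn.const_mul 2)) fun x => ?_
      have := norm_add_le (moll (bumpSeq k) (b n) x) ((b n - moll (bumpSeq k) (b n)) x)
      rw [Pi.sub_apply, add_sub_cancel] at this
      have h0 := norm_nonneg (b n x)
      simp only [Pi.sub_apply]
      nlinarith [sq_nonneg (‖moll (bumpSeq k) (b n) x‖ - ‖b n x - moll (bumpSeq k) (b n) x‖)]
    rw [integral_add (i1.const_mul 2) (i2.integrableOn.const_mul 2), integral_const_mul,
      integral_const_mul] at h1
    have h2 : ∫ x in Metric.ball 0 R, ‖(b n - moll (bumpSeq k) (b n)) x‖ ^ 2 ≤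
        ∫ x, ‖(b n - moll (bumpSeq k) (b n)) x‖ ^ 2 :=
      setIntegral_le_integral i2 (Eventually.of_forall fun x => by positivity)
    have h3 : (bumpSeq k).rOut ^ 2 * (3 * gradSq (b n)) ≤ (bumpSeq k).rOut ^ 2 * (3 * B) := by
      gcongr; exact hB n
    simp only [Pi.sub_apply] at h1 h2
    linarith
  have hr : Tendsto (fun k => 2 * ((bumpSeq k).rOut ^ 2 * (3 * B))) atTop (𝓝 0) := by
    have : Tendsto (fun k => (bumpSeq k).rOut) atTop (𝓝 0) :=
      tendsto_one_div_add_atTop_nhds_zero_nat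
    simpa using ((this.pow 2).mul_const (3 * B)).const_mul 2
  rw [Metric.tendsto_atTop]
  intro ε hε
  obtain ⟨k, hk⟩ := (hr.eventually (gt_mem_nhds (half_pos hε))).exists
  have h1 := (hmoll k).const_mul 2
  rw [mul_zero] at h1
  obtain ⟨N, hN⟩ := eventually_atTop.1 (h1.eventually (gt_mem_nhds (half_pos hε)))
  refine ⟨N, fun n hn => ?_⟩
  rw [Real.dist_0_eq_abs, abs_of_nonneg (integral_nonneg fun x => by positivity)]
  linarith [hbound k n, hN n hn]

/-! ### Vanishing of the cross terms and splitting of the energy. -/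

/-- Inside a ball `b n` is small in `L²`, outside it `f` is. Weighted AM-GM with different weights
`δ` and `K` in the two regions avoids square roots. -/
theorem tendsto_integral_mul_norm {f : R3 → ℝ} (hf : MemLp f 2 volume) (hf0 : 0 ≤ f)
    {b : ℕ → R3 → 𝕜} (hb : ∀ n, MemLp (b n) 2 volume) {A : ℝ} (hA : ∀ n, mass (b n) ≤ A)
    (hloc : ∀ R, Tendsto (fun n => ∫ x in Metric.ball 0 R, ‖b n x‖ ^ 2) atTop (𝓝 0)) :
    Tendsto (fun n => ∫ x, f x * ‖b n x‖) atTop (𝓝 0) := by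
  have hf2 : Integrable (fun x => f x ^ 2) volume := hf.integrable_sq
  have hA0 : 0 ≤ A := (mass_nonneg _).trans (hA 0)
  have hF0 : 0 ≤ ∫ x, f x ^ 2 := integral_nonneg fun x => by positivity
  have hbound {δ K : ℝ} (hδ : 0 < δ) (hK : 0 < K) (R : ℝ) (n : ℕ) : ∫ x, f x * ‖b n x‖ ≤
      (δ * (∫ x, f x ^ 2) + δ⁻¹ * ∫ x in Metric.ball 0 R, ‖b n x‖ ^ 2) +
        (K * ((∫ x, f x ^ 2) - ∫ x in Metric.ball 0 R, f x ^ 2) + K⁻¹ * A) := by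
    have hms : MeasurableSet (Metric.ball (0 : R3) R) := Metric.isOpen_ball.measurableSet
    have hb2 := integrable_norm_sq (hb n)
    have i1 := hf2.const_mul δ
    have i2 := (hb2.indicator hms).const_mul δ⁻¹
    have i3 := (hf2.sub (hf2.indicator hms)).const_mul K
    have i4 := hb2.const_mul K⁻¹
    have i5 : Integrable (fun x => f x * ‖b n x‖) volume := by
      refine (hf2.add hb2).mono' (hf.1.mul (hb n).1.norm) (Eventually.of_forall fun x => ?_)
      have := hf0 x
      simp only [Pi.zero_apply] at this
      rw [Real.norm_of_nonneg (by positivity), Pi.add_apply]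
      nlinarith [sq_nonneg (f x - ‖b n x‖), sq_nonneg (f x), sq_nonneg (‖b n x‖)]
    have key := integral_mono i5 ((i1.add i2).add (i3.add i4)) (fun x => by
      have hfx : 0 ≤ f x := hf0 x
      have ht := norm_nonneg (b n x)
      have amgm {c : ℝ} (hc : 0 < c) : f x * ‖b n x‖ ≤ c * f x ^ 2 + c⁻¹ * ‖b n x‖ ^ 2 := by
        have h1 : c * c⁻¹ = 1 := mul_inv_cancel₀ hc.ne'
        have h2 : 0 ≤ c⁻¹ * (c * f x - ‖b n x‖) ^ 2 := by positivity
        have h3 : c⁻¹ * (c * f x - ‖b n x‖) ^ 2 =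
            c * f x ^ 2 + c⁻¹ * ‖b n x‖ ^ 2 - 2 * (f x * ‖b n x‖) := by
          field_simp
          ring
        have : 0 ≤ f x * ‖b n x‖ := by positivity
        linarith
      simp only [Pi.add_apply, Pi.sub_apply]
      by_cases hx : x ∈ Metric.ball (0 : R3) R
      · simp only [Set.indicator_of_mem hx, sub_self, mul_zero, zero_add]
        have : 0 ≤ K⁻¹ * ‖b n x‖ ^ 2 := by positivity
        linarith [amgm hδ]
      · simp only [Set.indicator_of_notMem hx, sub_zero, mul_zero, add_zero]
        have : 0 ≤ δ * f x ^ 2 := by positivity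
        linarith [amgm hK])
    have e1 := integral_add (i1.add i2) (i3.add i4)
    have e2 := integral_add i1 i2
    have e3 := integral_add i3 i4
    have e4 := integral_sub hf2 (hf2.indicator hms)
    simp only [Pi.add_apply, Pi.sub_apply] at key e1 e2 e3 e4
    rw [integral_const_mul, integral_const_mul, integral_indicator hms] at e2
    rw [integral_const_mul, integral_const_mul, e4, integral_indicator hms] at e3
    have : K⁻¹ * ∫ x, ‖b n x‖ ^ 2 ≤ K⁻¹ * A := by
      gcongr; exact hA n
    linarith
  have htail : Tendsto (fun R : ℝ => (∫ x, f x ^ 2) - ∫ x in Metric.ball (0 : R3) R, f x ^ 2)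
      atTop (𝓝 0) := by
    have := (aecover_ball (μ := (volume : Measure R3)) (x := 0)
      (tendsto_id (α := ℝ) (x := atTop))).integral_tendsto_of_countably_generated hf2
    have h := this.const_sub (∫ x, f x ^ 2)
    rw [sub_self] at h
    exact h
  rw [Metric.tendsto_atTop]
  intro ε hε
  -- Order of choice: `δ` small and `K` large first, then `R` so that the tail of `f` is small
  -- compared with `1 / K`, and `N` last, depending on `δ` and `R`.
  obtain ⟨δ, hδ, hδε⟩ : ∃ δ : ℝ, 0 < δ ∧ δ * (∫ x, f x ^ 2) < ε / 4 := by
    refine ⟨ε / 4 / ((∫ x, f x ^ 2) + 1), by positivity, ?_⟩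
    rw [div_mul_eq_mul_div, div_lt_iff₀ (by positivity)]
    gcongr
    linarith
  obtain ⟨K, hK, hKε⟩ : ∃ K : ℝ, 0 < K ∧ K⁻¹ * A < ε / 4 := by
    refine ⟨(A + 1) / (ε / 4), by positivity, ?_⟩
    rw [inv_div, div_mul_eq_mul_div, div_lt_iff₀ (by positivity)]
    gcongr
    linarith
  have h1 := htail.const_mul K
  rw [mul_zero] at h1
  obtain ⟨R, hR⟩ := (h1.eventually (gt_mem_nhds (show 0 < ε / 4 by positivity))).exists
  have h2 := (hloc R).const_mul δ⁻¹
  rw [mul_zero] at h2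
  obtain ⟨N, hN⟩ := eventually_atTop.1
    (h2.eventually (gt_mem_nhds (show 0 < ε / 4 by positivity)))
  refine ⟨N, fun n hn => ?_⟩
  rw [Real.dist_0_eq_abs, abs_of_nonneg (integral_nonneg fun x =>
    mul_nonneg (hf0 x) (norm_nonneg _))]
  linarith [hbound hδ hK R n, hN n hn]

/-- AM-GM gives `‖b‖²‖v‖ ≤ δ‖b‖³ + δ⁻¹‖v‖²‖b‖`; the first integral is bounded and the second tends
to `0`. -/
theorem tendsto_integral_norm_sq_mul {v : R3 → 𝕜} (hv : v ∈ H1 𝕜) {b : ℕ → R3 → 𝕜}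
    (hb : ∀ n, b n ∈ H1 𝕜) {Q : ℝ} (hQ : ∀ n, powerInt (1 / 2) (b n) ≤ Q)
    (h : Tendsto (fun n => ∫ x, ‖v x‖ ^ 2 * ‖b n x‖) atTop (𝓝 0)) :
    Tendsto (fun n => ∫ x, ‖b n x‖ ^ 2 * ‖v x‖) atTop (𝓝 0) := by
  have hQ0 : 0 ≤ Q := by
    refine le_trans ?_ (hQ 0)
    rw [powerInt_half]
    exact integral_nonneg fun x => by positivity
  have hbound {δ : ℝ} (hδ : 0 < δ) (n : ℕ) : ∫ x, ‖b n x‖ ^ 2 * ‖v x‖ ≤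
      δ * Q + δ⁻¹ * ∫ x, ‖v x‖ ^ 2 * ‖b n x‖ := by
    have i1 := (integrable_norm_pow_three (hb n)).const_mul δ
    have i2 := (integrable_norm_sq_mul_norm hv (hb n)).const_mul δ⁻¹
    have key := integral_mono (integrable_norm_sq_mul_norm (hb n) hv) (i1.add i2) (fun x => by
      simp only [Pi.add_apply]
      have h2 : 0 ≤ δ⁻¹ * (δ * ‖b n x‖ - ‖v x‖) ^ 2 * ‖b n x‖ := by positivity
      have h3 : δ⁻¹ * (δ * ‖b n x‖ - ‖v x‖) ^ 2 * ‖b n x‖ = δ * ‖b n x‖ ^ 3 +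
          δ⁻¹ * (‖v x‖ ^ 2 * ‖b n x‖) - 2 * (‖b n x‖ ^ 2 * ‖v x‖) := by
        field_simp
        ring
      have : 0 ≤ ‖b n x‖ ^ 2 * ‖v x‖ := by positivity
      linarith)
    have e1 := integral_add i1 i2
    simp only [Pi.add_apply] at key e1
    rw [integral_const_mul, integral_const_mul] at e1
    have h4 := hQ n
    rw [powerInt_half] at h4
    have := mul_le_mul_of_nonneg_left h4 hδ.le
    linarith
  rw [Metric.tendsto_atTop]
  intro ε hε
  obtain ⟨δ, hδ, hδε⟩ : ∃ δ : ℝ, 0 < δ ∧ δ * Q < ε / 2 := by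
    refine ⟨ε / 2 / (Q + 1), by positivity, ?_⟩
    rw [div_mul_eq_mul_div, div_lt_iff₀ (by positivity)]
    gcongr
    linarith
  have h2 := h.const_mul δ⁻¹
  rw [mul_zero] at h2
  obtain ⟨N, hN⟩ := eventually_atTop.1 (h2.eventually (gt_mem_nhds (half_pos hε)))
  refine ⟨N, fun n hn => ?_⟩
  rw [Real.dist_0_eq_abs, abs_of_nonneg (integral_nonneg fun x => by positivity)]
  linarith [hbound hδ n, hN n hn]

theorem HasPotentialBound.mono {f : R3 → ℝ} {V W : ℝ} (hf : HasPotentialBound f V)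
    (h : V ≤ W) : HasPotentialBound f W :=
  fun x => ⟨(hf x).1, (hf x).2.trans h⟩

/-- Splitting of the energy along a weakly convergent sequence in `H¹`, up to a vanishing error. -/
theorem exists_energy_splitting {C : ℝ} (hC : 0 ≤ C) {u : ℕ → R3 → 𝕜} {v : R3 → 𝕜}
    (hu : ∀ n, u n ∈ H1 𝕜) (hv : v ∈ H1 𝕜) {A B : ℝ}
    (hA : ∀ n, mass (fun x => u n x - v x) ≤ A)
    (hB : ∀ n, gradSq (fun x => u n x - v x) ≤ B)
    (hloc : ∀ R, Tendsto (fun n => ∫ x in Metric.ball 0 R, ‖u n x - v x‖ ^ 2) atTop (𝓝 0))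
    (hgrad : ∀ i, WeakL2Tendsto (fun n => weakPartial i (u n)) (weakPartial i v)) :
    ∃ r : ℕ → ℝ, Tendsto r atTop (𝓝 0) ∧ ∀ n,
      energy (1 / 2) C v + energy (1 / 2) C (fun x => u n x - v x) ≤
        energy (1 / 2) C (u n) + r n := by
  obtain ⟨K, hK, h6⟩ := exists_integral_pow_six_le 𝕜
  let b : ℕ → R3 → 𝕜 := fun n x => u n x - v x
  have hb n : b n ∈ H1 𝕜 := sub_mem_H1 (hu n) hv
  have hb6 n : ∫ x, ‖b n x‖ ^ 6 ≤ K * (A + B) ^ 3 := by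
    refine (h6 _ (hb n)).trans ?_
    have := mass_nonneg (b n)
    have := gradSq_nonneg (b n)
    gcongr
    · exact hA n
    · exact hB n
  have hQ n : powerInt (1 / 2) (b n) ≤ A + K * (A + B) ^ 3 := by
    refine (powerInt_half_le (hb n) one_pos).trans ?_
    have h1 := hA n
    have h2 := hb6 n
    simp only [one_mul, one_pow, div_one]
    exact add_le_add h1 h2
  -- A potential bound independent of `n`, from the uniform mass and `L⁶` bounds on `b n`.
  set V := mass v + (∫ x, ‖v x‖ ^ 6) + ballConst + (A + K * (A + B) ^ 3 + ballConst)
  have hV n : HasPotentialBound (fun x => ‖v x‖ ^ 2 + ‖b n x‖ ^ 2) V := by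
    refine ((hasPotentialBound_norm_sq hv).add (hasPotentialBound_norm_sq (hb n))).mono ?_
    have h1 : mass (b n) ≤ A := hA n
    have h2 := hb6 n
    simp only [V]
    linarith
  have hvm : MemLp (fun x => ‖v x‖ ^ 2) 2 volume := by
    refine (memLp_two_iff_integrable_sq (hv.1.1.norm.pow 2)).2 ?_
    refine (integrable_norm_pow_four hv).congr (Eventually.of_forall fun x => ?_)
    simp only [Pi.pow_apply, ← pow_mul]
  have t1 : Tendsto (fun n => ∫ x, ‖v x‖ * ‖b n x‖) atTop (𝓝 0) :=
    tendsto_integral_mul_norm hv.1.norm (fun _ => norm_nonneg _) (fun n => (hb n).1) hA hloc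
  have t2 : Tendsto (fun n => ∫ x, ‖v x‖ ^ 2 * ‖b n x‖) atTop (𝓝 0) :=
    tendsto_integral_mul_norm hvm (fun _ => by positivity) (fun n => (hb n).1) hA hloc
  have t3 := tendsto_integral_norm_sq_mul hv hb hQ t2
  have t4 := tendsto_gradSq_sub hu hv hgrad
  -- The coefficients are `V = 1/4 · 4V` from the Coulomb term and `C = C/3 · 3` from the cubic one.
  refine ⟨fun n => 1 / 2 * (gradSq v + gradSq (b n) - gradSq (u n)) +
    V * (∫ x, ‖v x‖ * ‖b n x‖) +
    C * ((∫ x, ‖v x‖ ^ 2 * ‖b n x‖) + ∫ x, ‖b n x‖ ^ 2 * ‖v x‖), ?_, fun n => ?_⟩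
  · have h := ((t4.const_mul (1 / 2)).add (t1.const_mul V)).add ((t2.add t3).const_mul C)
    simp only [mul_zero, add_zero] at h
    exact h
  · have hub : (fun x => v x + b n x) = u n := by
      ext x
      simp [b]
    have hmem : (fun x => v x + b n x) ∈ H1 𝕜 := hub ▸ hu n
    have h1 := coulomb_add_le hv (hb n) hmem (hV n)
    have h2 := mul_le_mul_of_nonneg_left (powerInt_half_add_le hv (hb n) hmem)
      (show 0 ≤ C / 3 by positivity)
    rw [hub] at h1 h2
    change energy (1 / 2) C v + energy (1 / 2) C (b n) ≤ _
    simp only [energy_half]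
    linarith

theorem setIntegral_ball_rescale (u : R3 → 𝕜) (y : R3) (R : ℝ) :
    ∫ x in Metric.ball 0 R, ‖rescale 1 1 y u x‖ ^ 2 = ∫ x in Metric.ball y R, ‖u x‖ ^ 2 := by
  rw [← (measurePreserving_add_right volume y).setIntegral_preimage_emb
    (measurableEmbedding_addRight y) (fun x => ‖u x‖ ^ 2) (Metric.ball y R)]
  simp [rescale]

end XSP

end

/-! ### Construction of the minimizer. -/

theorem proposition3p3 {𝕜 : Type*} [RCLike 𝕜] (α C : ℝ) (hα : α = 1 / 2)
    (hC : C = 3 / (Real.sqrt 2 * XSP.bestConst 𝕜 (1 / 2)))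
    (φ : ℕ → XSP.R3 → 𝕜) (hφ : XSP.IsMinimizingSeq α C 1 φ)
    (hnv : XSP.Nonvanishing φ) :
    ∃ ψ : XSP.R3 → 𝕜, XSP.IsMinimizer α C 1 ψ := by
  open XSP in
  subst hα
  have hC0 : 0 ≤ C := by
    rw [hC]
    have := bestConst_nonneg 𝕜 (1 / 2)
    positivity
  obtain ⟨hmem, hlim⟩ := hφ
  obtain ⟨R, -, ε, hε, y, hy⟩ := hnv
  rw [infEnergy_half_eq_zero hC (hmem 0)] at hlim
  have hE : Tendsto (fun n => energy (1 / 2) C (φ n)) atTop (𝓝 0) := by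
    rw [← EReal.tendsto_coe, EReal.coe_zero]
    exact hlim
  obtain ⟨B, hB⟩ := exists_gradSq_le 𝕜 hC0
  -- Dropping the first `N` terms makes every energy at most `1`, as the gradient bound requires.
  obtain ⟨N, hN⟩ := eventually_atTop.1 (hE.eventually (ge_mem_nhds one_pos))
  let u : ℕ → R3 → 𝕜 := fun n => rescale 1 1 (y (n + N)) (φ (n + N))
  have hu n : u n ∈ H1 𝕜 := rescale_mem_H1 (hmem _).1 _ one_pos _
  have hum n : mass (u n) = 1 := by
    simp only [u]
    rw [mass_rescale _ _ one_pos, (hmem _).2]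
    norm_num
  have huE n : energy (1 / 2) C (u n) = energy (1 / 2) C (φ (n + N)) :=
    energy_half_translate (hmem _).1 C _
  have huG n : gradSq (u n) ≤ B :=
    hB _ (hu n) (hum n) ((huE n).trans_le (hN _ (Nat.le_add_left N n)))
  have huR n : ε ≤ ∫ x in Metric.ball 0 R, ‖u n x‖ ^ 2 := by
    simp only [u]
    rw [setIntegral_ball_rescale]
    exact hy _
  obtain ⟨v, hv, σ, hσ, hw, hwg⟩ := exists_weak_subseq_H1 hu (fun n => (hum n).le) huG
  let b : ℕ → R3 → 𝕜 := fun n x => u (σ n) x - v x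
  have hb n : b n ∈ H1 𝕜 := sub_mem_H1 (hu _) hv
  have hbA n : mass (b n) ≤ 2 * 1 + 2 * mass v := by
    have := integral_norm_sub_sq_le (hu (σ n)).1 hv.1
    rw [← hum (σ n)]
    exact this
  have hbB n : gradSq (b n) ≤ 2 * B + 2 * gradSq v :=
    (gradSq_sub_le (hu _) hv).trans (by linarith [huG (σ n)])
  have hb0 : WeakL2Tendsto b 0 := by
    intro g hg
    have h1 := (hw g hg).sub_const (∫ x, inner 𝕜 (g x) (v x))
    rw [sub_self] at h1
    simp only [Pi.zero_apply, inner_zero_right, integral_zero]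
    refine h1.congr fun n => ?_
    rw [← integral_sub (integrable_inner_of_memLp hg (hu _).1) (integrable_inner_of_memLp hg hv.1)]
    simp only [b, inner_sub_right]
  have hloc := tendsto_setIntegral_ball_of_weak hb hbA hbB hb0
  -- The mass `ε` stays in a fixed ball, where the remainder `b n` tends to `0` in `L²`; so `v` must
  -- carry it.
  have hmv : 0 < mass v := by
    have h1 n : ε ≤ 2 * (∫ x in Metric.ball 0 R, ‖b n x‖ ^ 2) + 2 * mass v := by
      have i1 := ((integrable_norm_sq (hb n).1).integrableOn
        (s := Metric.ball (0 : R3) R)).const_mul 2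
      have i2 := ((integrable_norm_sq hv.1).integrableOn
        (s := Metric.ball (0 : R3) R)).const_mul 2
      have h2 : ∫ x in Metric.ball 0 R, ‖u (σ n) x‖ ^ 2 ≤
          ∫ x in Metric.ball 0 R, (2 * ‖b n x‖ ^ 2 + 2 * ‖v x‖ ^ 2) := by
        refine integral_mono (integrable_norm_sq (hu _).1).integrableOn (i1.add i2) fun x => ?_
        have h3 := norm_add_le (b n x) (v x)
        simp only [b, sub_add_cancel] at h3 ⊢
        nlinarith [sq_nonneg (‖u (σ n) x - v x‖ - ‖v x‖), norm_nonneg (u (σ n) x)]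
      rw [integral_add i1 i2, integral_const_mul, integral_const_mul] at h2
      have h3 : ∫ x in Metric.ball 0 R, ‖v x‖ ^ 2 ≤ mass v :=
        setIntegral_le_integral (integrable_norm_sq hv.1)
          (Eventually.of_forall fun x => by positivity)
      linarith [huR (σ n)]
    have h2 := ((hloc R).const_mul 2).add_const (2 * mass v)
    have h3 := ge_of_tendsto' h2 h1
    linarith
  obtain ⟨r, hr, hsplit⟩ := exists_energy_splitting hC0 (fun n => hu (σ n)) hv hbA hbB hloc hwg
  have hEv : energy (1 / 2) C v ≤ 0 := by
    have h1 : Tendsto (fun n => energy (1 / 2) C (u (σ n)) + r n) atTop (𝓝 (0 + 0)) := by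
      refine Tendsto.add ?_ hr
      simp only [huE]
      exact hE.comp ((tendsto_add_atTop_nat N).comp hσ.tendsto_atTop)
    rw [add_zero] at h1
    refine ge_of_tendsto' h1 fun n => ?_
    have := energy_half_nonneg hC (hb n)
    linarith [hsplit n]
  -- The mass of `v` need not be `1`; rescaling restores it without changing the zero energy.
  exact exists_isMinimizer_of_energy_eq_zero hC hv hmv (hEv.antisymm (energy_half_nonneg hC hv))
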